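/- Let $(N,g,j)$ be an oriented smooth Riemannian surface, where $j$ is the compatible complex structure (rotation by a right angle). Let $TN$ be the total space of its tangent bundle with the following structures: $\mathbb{J}=j\oplus j$ with respect to the splitting $TTN\cong TN\oplus TN$ into horizontal and vertical parts given by the Levi-Civita connection of $g$; $\Omega$, the pullback of the canonical symplectic form of $T^*N$ (the exterior derivative of the tautological one-form) by the map $TN\to T^*N$, $v\mapsto g(v,\cdot)$; and the neutral metric $\mathbb{G}(\cdot,\cdot)=\Omega(\mathbb{J}\cdot,\cdot)$. Let $\Sigma$ be a non-empty closed surface (a compact smooth $2$-manifold without boundary) smoothly immersed in $TN$. Then the metric induced on $\Sigma$ by $\mathbb{G}$ is not positive definite everywhere, and it is not negative definite everywhere. More precisely, there is a point of $\Sigma$ at which the pullback of $\Omega$ to $\Sigma$ vanishes and at which the induced metric is either degenerate or Lorentz (of signature $(+,-)$). -/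

import Mathlib

open Bundle Manifold
open scoped ContDiff

noncomputable section

namespace NeutralKahler

/-! ### Differential forms on a boundaryless manifold -/

section Forms

variable {E : Type*} [NormedAddCommGroup E] [NormedSpace ℝ E]
  {H : Type*} [TopologicalSpace H] (I : ModelWithCorners ℝ E H) [I.Boundaryless]
  {M : Type*} [TopologicalSpace M] [ChartedSpace H M]

/-- The expression of a differential `k`-form in the preferred chart at `p`, i.e. its pullback
by the inverse of that chart. -/
def formInChart {k : ℕ} (η : (q : M) → TangentSpace I q [⋀^Fin k]→L[ℝ] ℝ) (p : M) (y : E) :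
    E [⋀^Fin k]→L[ℝ] ℝ :=
  (η ((extChartAt I p).symm y)).compContinuousLinearMap
    (mfderiv 𝓘(ℝ, E) I (extChartAt I p).symm y)

/-- The exterior derivative of a differential `k`-form on a manifold, computed at `p` in the
preferred chart at `p`. -/
def extDerivForm {k : ℕ} (η : (q : M) → TangentSpace I q [⋀^Fin k]→L[ℝ] ℝ) (p : M) :
    TangentSpace I p [⋀^Fin (k + 1)]→L[ℝ] ℝ :=
  ContinuousAlternatingMap.compContinuousLinearMap
    (extDeriv (formInChart I η p) (extChartAt I p p))
    (mfderiv I 𝓘(ℝ, E) (extChartAt I p) p : TangentSpace I p →L[ℝ] E)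

end Forms

/-- The Euclidean plane, on which surfaces are modelled. -/
abbrev Plane : Type := EuclideanSpace ℝ (Fin 2)

variable {N : Type*} [TopologicalSpace N] [ChartedSpace Plane N] [IsManifold (𝓡 2) ∞ N]

/-! ### The canonical symplectic form of the cotangent bundle -/

variable (N) in
/-- The total space `T*N` of the cotangent bundle of the surface `N`. -/
abbrev CotangentBundle : Type _ :=
  TotalSpace (Plane →L[ℝ] ℝ) (fun x : N ↦ TangentSpace (𝓡 2) x →L[ℝ] ℝ)

/-- The model with corners of `T*N`. -/
abbrev cotangentModel : ModelWithCorners ℝ (Plane × (Plane →L[ℝ] ℝ))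
    (ModelProd Plane (Plane →L[ℝ] ℝ)) :=
  (𝓡 2).prod 𝓘(ℝ, Plane →L[ℝ] ℝ)

/-- The tautological one-form of `T*N`: its value on a vector `W` tangent to `T*N` at the covector
`α` is `α (dπ W)`. -/
def tautologicalForm (α : CotangentBundle N) :
    TangentSpace cotangentModel α [⋀^Fin 1]→L[ℝ] ℝ :=
  ContinuousAlternatingMap.ofSubsingleton ℝ (TangentSpace cotangentModel α) ℝ (0 : Fin 1)
    (α.2.comp (mfderiv cotangentModel (𝓡 2) (fun β : CotangentBundle N ↦ β.1) α))

/-- The canonical symplectic form of `T*N`, the exterior derivative of the tautological form. -/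
def canonicalSymplecticForm (α : CotangentBundle N) :
    TangentSpace cotangentModel α [⋀^Fin 2]→L[ℝ] ℝ :=
  extDerivForm cotangentModel (tautologicalForm (N := N)) α

/-! ### Oriented Riemannian surfaces -/

variable (N) in
/-- Smooth Riemannian metrics on `N`. -/
abbrev SurfaceMetric : Type _ :=
  ContMDiffRiemannianMetric (𝓡 2) ∞ Plane (fun x : N ↦ TangentSpace (𝓡 2) x)

/-- A smooth complex structure `j` on the tangent planes of `N` which is compatible with the
Riemannian metric `g`, i.e. the rotation by a right angle of an orientation of `N`. -/
structure CompatibleComplexStructure (g : SurfaceMetric N) where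
  /-- The endomorphism of each tangent plane. -/
  rot (x : N) : TangentSpace (𝓡 2) x →L[ℝ] TangentSpace (𝓡 2) x
  rot_rot (x : N) (v : TangentSpace (𝓡 2) x) : rot x (rot x v) = -v
  inner_rot (x : N) (v w : TangentSpace (𝓡 2) x) :
    g.inner x (rot x v) (rot x w) = g.inner x v w
  contMDiff : ContMDiff (𝓡 2) ((𝓡 2).prod 𝓘(ℝ, Plane →L[ℝ] Plane)) ∞
    (fun x ↦ TotalSpace.mk' (Plane →L[ℝ] Plane)
      (E := fun x : N ↦ TangentSpace (𝓡 2) x →L[ℝ] TangentSpace (𝓡 2) x) x (rot x))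

/-- The metric as a mapping `TN → T*N`. -/
def flat (g : SurfaceMetric N) (p : TangentBundle (𝓡 2) N) : CotangentBundle N :=
  ⟨p.1, g.inner p.1 p.2⟩

/-! ### The Levi-Civita connection and the splitting `TTN ≅ TN ⊕ TN` -/

/-- The differential at `x` of the preferred chart at `x`. -/
def chartDeriv (x : N) : TangentSpace (𝓡 2) x →L[ℝ] Plane :=
  mfderiv (𝓡 2) 𝓘(ℝ, Plane) (extChartAt (𝓡 2) x) x

/-- The differential at `y` of the inverse of the preferred chart at `x`. -/
def chartSymmDeriv (x : N) (y : Plane) :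
    Plane →L[ℝ] TangentSpace (𝓡 2) ((extChartAt (𝓡 2) x).symm y) :=
  mfderiv 𝓘(ℝ, Plane) (𝓡 2) (extChartAt (𝓡 2) x).symm y

/-- The `i`-th vector of the standard basis of the plane. -/
def stdVec (i : Fin 2) : Plane := EuclideanSpace.single i 1

/-- The matrix `g_{ij}` of the metric in the preferred chart at `x`, as a function of the
coordinates `y`. -/
def metricMatrix (g : SurfaceMetric N) (x : N) (y : Plane) : Matrix (Fin 2) (Fin 2) ℝ :=
  Matrix.of fun i j ↦ g.inner ((extChartAt (𝓡 2) x).symm y)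
    (chartSymmDeriv x y (stdVec i)) (chartSymmDeriv x y (stdVec j))

/-- The partial derivative `∂_k g_{ij}` at the point `x`, in the preferred chart at `x`. -/
def metricPartial (g : SurfaceMetric N) (x : N) (k i j : Fin 2) : ℝ :=
  fderiv ℝ (fun y ↦ metricMatrix g x y i j) (extChartAt (𝓡 2) x x) (stdVec k)

/-- The Christoffel symbol `Γ^k_{ij}` of the Levi-Civita connection at the point `x`, in the
preferred chart at `x`. -/
def christoffel (g : SurfaceMetric N) (x : N) (k i j : Fin 2) : ℝ :=
  1 / 2 * ∑ l, (metricMatrix g x (extChartAt (𝓡 2) x x))⁻¹ k l *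
    (metricPartial g x i j l + metricPartial g x j i l - metricPartial g x l i j)

/-- For a vector `v` of coordinates `v^j`, the map `a ↦ ∑ Γ^k_{ij} a^i v^j` in the coordinates of
the preferred chart at `x`. -/
def christoffelMap (g : SurfaceMetric N) (x : N) (v : Plane) : Plane →L[ℝ] Plane :=
  ∑ k, ∑ i, ∑ j, (christoffel g x k i j * v j) •
    (EuclideanSpace.proj i : Plane →L[ℝ] ℝ).smulRight (stdVec k)

/-- The differential of the projection `TN → N`. -/
def projDeriv (p : TangentBundle (𝓡 2) N) :
    TangentSpace (𝓡 2).tangent p →L[ℝ] TangentSpace (𝓡 2) p.1 :=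
  mfderiv (𝓡 2).tangent (𝓡 2) (fun q : TangentBundle (𝓡 2) N ↦ q.1) p

/-- The fibre coordinates on `TN` induced by the preferred chart at `x`. -/
def fibreCoord (x : N) (q : TangentBundle (𝓡 2) N) : Plane :=
  (trivializationAt Plane (fun z : N ↦ TangentSpace (𝓡 2) z) x q).2

/-- The differential at `p` of the fibre coordinates induced by the preferred chart at the base
point of `p`. -/
def fibreDeriv (p : TangentBundle (𝓡 2) N) : TangentSpace (𝓡 2).tangent p →L[ℝ] Plane :=
  mfderiv (𝓡 2).tangent 𝓘(ℝ, Plane) (fibreCoord p.1) p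

/-- The connection map `TTN → TN` of the Levi-Civita connection. In the coordinates `(x, v)` of
`TN` induced by a chart of `N` it sends the tangent vector `(x', v')` to the vector of
coordinates `v'^k + ∑ Γ^k_{ij} x'^i v^j`. -/
def connectionMap (g : SurfaceMetric N) (p : TangentBundle (𝓡 2) N) :
    TangentSpace (𝓡 2).tangent p →L[ℝ] TangentSpace (𝓡 2) p.1 :=
  (chartDeriv p.1).inverse.comp
    (fibreDeriv p +
      (christoffelMap g p.1 (chartDeriv p.1 p.2)).comp ((chartDeriv p.1).comp (projDeriv p)))

/-- The splitting `TTN ≅ TN ⊕ TN` into horizontal and vertical parts defined by the Levi-Civita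
connection. -/
def splitting (g : SurfaceMetric N) (p : TangentBundle (𝓡 2) N) :
    TangentSpace (𝓡 2).tangent p →L[ℝ] TangentSpace (𝓡 2) p.1 × TangentSpace (𝓡 2) p.1 :=
  (projDeriv p).prod (connectionMap g p)

theorem chartDeriv_eq (x : N) : chartDeriv x = ContinuousLinearMap.id ℝ Plane :=
  mfderiv_extChartAt_self

theorem fibreDeriv_eq (p : TangentBundle (𝓡 2) N) :
    fibreDeriv p = ContinuousLinearMap.snd ℝ Plane Plane := by
  have h : fibreCoord p.1 = Prod.snd ∘ (extChartAt (𝓡 2).tangent p) := by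
    ext1 q
    rw [FiberBundle.extChartAt]
    rfl
  have h1 : MDifferentiableAt (𝓡 2).tangent 𝓘(ℝ, Plane × Plane)
      (extChartAt (𝓡 2).tangent p) p := mdifferentiableAt_extChartAt (by simp)
  have h2 : HasMFDerivAt 𝓘(ℝ, Plane × Plane) 𝓘(ℝ, Plane) (Prod.snd : Plane × Plane → Plane)
      (extChartAt (𝓡 2).tangent p p) (ContinuousLinearMap.snd ℝ Plane Plane) :=
    hasFDerivAt_snd.hasMFDerivAt
  have h3 := (h2.comp p h1.hasMFDerivAt).mfderiv
  rw [mfderiv_extChartAt_self] at h3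
  unfold fibreDeriv
  rw [h]
  exact h3

theorem projDeriv_eq (p : TangentBundle (𝓡 2) N) :
    projDeriv p = ContinuousLinearMap.fst ℝ Plane Plane := by
  have h : (extChartAt (𝓡 2) p.1) ∘ (fun q : TangentBundle (𝓡 2) N ↦ q.1)
      = Prod.fst ∘ (extChartAt (𝓡 2).tangent p) := by
    ext1 q
    rw [FiberBundle.extChartAt]
    rfl
  have h1 : MDifferentiableAt (𝓡 2).tangent 𝓘(ℝ, Plane × Plane)
      (extChartAt (𝓡 2).tangent p) p := mdifferentiableAt_extChartAt (by simp)
  have h2 : HasMFDerivAt 𝓘(ℝ, Plane × Plane) 𝓘(ℝ, Plane) (Prod.fst : Plane × Plane → Plane)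
      (extChartAt (𝓡 2).tangent p p) (ContinuousLinearMap.fst ℝ Plane Plane) :=
    hasFDerivAt_fst.hasMFDerivAt
  have h3 := (h2.comp p h1.hasMFDerivAt).mfderiv
  rw [mfderiv_extChartAt_self] at h3
  have h4 : MDifferentiableAt (𝓡 2).tangent (𝓡 2) (fun q : TangentBundle (𝓡 2) N ↦ q.1) p :=
    mdifferentiableAt_proj _
  have h5 : MDifferentiableAt (𝓡 2) 𝓘(ℝ, Plane) (extChartAt (𝓡 2) p.1) p.1 :=
    mdifferentiableAt_extChartAt (by simp)
  have h6 := mfderiv_comp p h5 h4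
  rw [h] at h6
  have h7 := h6.symm.trans h3
  rw [mfderiv_extChartAt_self] at h7
  exact h7

theorem shear_isInvertible (A : Plane →L[ℝ] Plane) :
    ((ContinuousLinearMap.fst ℝ Plane Plane).prod
      (ContinuousLinearMap.snd ℝ Plane Plane
        + A.comp (ContinuousLinearMap.fst ℝ Plane Plane))).IsInvertible :=
  ContinuousLinearMap.IsInvertible.of_inverse
    (g := (ContinuousLinearMap.fst ℝ Plane Plane).prod
      (ContinuousLinearMap.snd ℝ Plane Plane - A.comp (ContinuousLinearMap.fst ℝ Plane Plane)))
    (by ext <;> simp) (by ext <;> simp)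

/-- The splitting is indeed an isomorphism `T_p TN ≅ T_x N ⊕ T_x N`. -/
theorem splitting_isInvertible (g : SurfaceMetric N) (p : TangentBundle (𝓡 2) N) :
    (splitting g p).IsInvertible := by
  let A : Plane →L[ℝ] Plane := christoffelMap g p.1 p.2
  have hs : splitting g p = (ContinuousLinearMap.fst ℝ Plane Plane).prod
      (ContinuousLinearMap.snd ℝ Plane Plane + A.comp (ContinuousLinearMap.fst ℝ Plane Plane)) := by
    unfold splitting connectionMap
    rw [projDeriv_eq, fibreDeriv_eq, chartDeriv_eq]
    erw [ContinuousLinearMap.inverse_id]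
    rfl
  rw [hs]
  exact shear_isInvertible A

/-! ### The neutral Kähler structure of `TN` -/

/-- The complex structure `J = j ⊕ j` on `TN`. -/
def complexStructure (g : SurfaceMetric N) (j : CompatibleComplexStructure g)
    (p : TangentBundle (𝓡 2) N) :
    TangentSpace (𝓡 2).tangent p →L[ℝ] TangentSpace (𝓡 2).tangent p :=
  (splitting g p).inverse.comp (((j.rot p.1).prodMap (j.rot p.1)).comp (splitting g p))

/-- The symplectic form `Ω` on `TN`: the pullback of the canonical symplectic form of `T*N` by the
metric, seen as a mapping `TN → T*N`. -/
def symplecticForm (g : SurfaceMetric N) (p : TangentBundle (𝓡 2) N) :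
    TangentSpace (𝓡 2).tangent p [⋀^Fin 2]→L[ℝ] ℝ :=
  (canonicalSymplecticForm (flat g p)).compContinuousLinearMap
    (mfderiv (𝓡 2).tangent cotangentModel (flat g) p)

/-- The neutral metric on `TN`, `G(X, Y) = Ω(J X, Y)`. -/
def neutralMetric (g : SurfaceMetric N) (j : CompatibleComplexStructure g)
    (p : TangentBundle (𝓡 2) N) (X Y : TangentSpace (𝓡 2).tangent p) : ℝ :=
  symplecticForm g p ![complexStructure g j p X, Y]

/-! ### Surfaces in `TN` -/

section Surfaces

variable {S : Type*} [TopologicalSpace S] [ChartedSpace Plane S]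

/-- The differential at `s` of a map from a surface `S` to `TN`. -/
def surfaceDeriv (f : S → TangentBundle (𝓡 2) N) (s : S) :
    TangentSpace (𝓡 2) s →L[ℝ] TangentSpace (𝓡 2).tangent (f s) :=
  mfderiv (𝓡 2) (𝓡 2).tangent f s

/-- A smooth immersion of the surface `S` into `TN`. -/
def IsImmersedSurface (f : S → TangentBundle (𝓡 2) N) : Prop :=
  ContMDiff (𝓡 2) (𝓡 2).tangent ∞ f ∧ ∀ s, Function.Injective (surfaceDeriv f s)

/-- The pullback of the symplectic form to `S`. -/
def inducedForm (g : SurfaceMetric N) (f : S → TangentBundle (𝓡 2) N) (s : S) :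
    TangentSpace (𝓡 2) s [⋀^Fin 2]→L[ℝ] ℝ :=
  (symplecticForm g (f s)).compContinuousLinearMap (surfaceDeriv f s)

/-- The metric induced on `S` by the neutral metric of `TN`. -/
def inducedMetric (g : SurfaceMetric N) (j : CompatibleComplexStructure g)
    (f : S → TangentBundle (𝓡 2) N) (s : S) (a b : TangentSpace (𝓡 2) s) : ℝ :=
  neutralMetric g j (f s) (surfaceDeriv f s a) (surfaceDeriv f s b)

end Surfaces

section Signature

variable {V : Type*} [AddCommGroup V] [Module ℝ V]

/-- A bilinear form is positive definite. -/
def IsPositiveDefinite (h : V → V → ℝ) : Prop := ∀ a, a ≠ 0 → 0 < h a a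

/-- A bilinear form is negative definite. -/
def IsNegativeDefinite (h : V → V → ℝ) : Prop := ∀ a, a ≠ 0 → h a a < 0

/-- A symmetric bilinear form is degenerate. -/
def IsDegenerate (h : V → V → ℝ) : Prop := ∃ a, a ≠ 0 ∧ ∀ b, h a b = 0

/-- A symmetric bilinear form on a plane is Lorentz, i.e. has signature `(+, -)`. -/
def IsLorentz (h : V → V → ℝ) : Prop := ∃ a b, 0 < h a a ∧ h b b < 0 ∧ h a b = 0

end Signature

end NeutralKahler

end

namespace NeutralKahler

open MeasureTheory Set Filter Topology

/-! The form `Ω` is exact, so its pullback to the surface is exact. An exact two-form on a non-empty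
closed surface vanishes somewhere (`exists_eq_zero_of_exact`), so there is a Lagrangian point, and
the rest is linear algebra there.

Were the exact form `Ω = dη` nowhere zero, its density `|Ω|` would have positive total mass. For a
partition of unity `ρ c` subordinate to charts, the quotients `d(ρ c η) / Ω` add up to `dη / Ω = 1`,
while each of them has integral zero against `|Ω|`, by Stokes in one chart. So the total mass is
zero, a contradiction. Working with `|Ω|` makes an orientation of the surface unnecessary.

In the Levi-Civita splitting `Ω(X, Y) = g(X₂, Y₁) - g(Y₂, X₁)` (`symplecticForm_apply`): the Koszul
formula matches the Christoffel terms with the derivatives of the metric. Let a tangent plane be the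
image of `(A₁, A₂)`. A dimension count gives `(a, b) ≠ 0` with `A₁ a + j A₁ b = 0`; if the plane is
Lagrangian, the induced metric `h` then satisfies `h a a + h b b = 0`. Hence `h` is not definite,
and on a plane this means degenerate or Lorentz (`isDegenerate_or_isLorentz_of_lagrangian`). -/

/-! ### Exterior derivatives of one-forms and Stokes on a vector space -/

theorem extDeriv_one_form_apply {E : Type*} [NormedAddCommGroup E] [NormedSpace ℝ E]
    (θ : E → E [⋀^Fin 1]→L[ℝ] ℝ) (y u v : E) :
    extDeriv θ y ![u, v] = fderiv ℝ θ y u ![v] - fderiv ℝ θ y v ![u] := by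
  rw [extDeriv, ContinuousAlternatingMap.alternatizeUncurryFin_apply, Fin.sum_univ_two]
  have h0 : (0 : Fin 2).removeNth ![u, v] = ![v] := by
    ext i; fin_cases i; rfl
  have h1 : (1 : Fin 2).removeNth ![u, v] = ![u] := by
    ext i; fin_cases i; rfl
  rw [h0, h1]
  simp [sub_eq_add_neg]

theorem extDeriv_smul_one_form_apply {E : Type*} [NormedAddCommGroup E] [NormedSpace ℝ E]
    {r : E → ℝ} {θ : E → E [⋀^Fin 1]→L[ℝ] ℝ} {y : E} (hr : DifferentiableAt ℝ r y)
    (hθ : DifferentiableAt ℝ θ y) (u v : E) :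
    extDeriv (fun z ↦ r z • θ z) y ![u, v] = r y * extDeriv θ y ![u, v] +
      (fderiv ℝ r y u * θ y ![v] - fderiv ℝ r y v * θ y ![u]) := by
  rw [extDeriv_one_form_apply, extDeriv_one_form_apply, fderiv_fun_smul hr hθ]
  simp
  ring

/-- The integral of the derivative of a compactly supported function vanishes. -/
theorem integral_fderiv_apply_eq_zero {E : Type*} [NormedAddCommGroup E] [NormedSpace ℝ E]
    [FiniteDimensional ℝ E] [MeasurableSpace E] [BorelSpace E] {μ : Measure E}
    [μ.IsAddHaarMeasure] {f : E → ℝ} (hf : ContDiff ℝ 1 f) (hc : HasCompactSupport f) (v : E) :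
    ∫ y, fderiv ℝ f y v ∂μ = 0 := by
  have h1 : Integrable (fun y ↦ fderiv ℝ f y v) μ :=
    ((hf.continuous_fderiv one_ne_zero).clm_apply continuous_const).integrable_of_hasCompactSupport
      (hc.fderiv_apply ℝ v)
  have h2 : Integrable f μ := hf.continuous.integrable_of_hasCompactSupport hc
  -- Integration by parts against the constant function `1`.
  have h := integral_mul_fderiv_eq_neg_fderiv_mul_of_integrable (μ := μ) (f := fun _ : E ↦ (1 : ℝ))
    (g := f) (v := v) (by simp) (by simpa using h1) (by simpa using h2)
    (fun _ _ ↦ differentiableAt_const _) (fun x _ ↦ (hf.differentiable one_ne_zero x))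
  simpa using h

/-- The integral of the exterior derivative of a compactly supported one-form vanishes. -/
theorem integral_extDeriv_eq_zero {E : Type*} [NormedAddCommGroup E] [NormedSpace ℝ E]
    [FiniteDimensional ℝ E] [MeasurableSpace E] [BorelSpace E] {μ : Measure E}
    [μ.IsAddHaarMeasure] {θ : E → E [⋀^Fin 1]→L[ℝ] ℝ} (hθ : ContDiff ℝ 1 θ)
    (hc : HasCompactSupport θ) (u v : E) :
    ∫ y, extDeriv θ y ![u, v] ∂μ = 0 := by
  have key (a : E) : ContDiff ℝ 1 (fun y ↦ θ y ![a]) ∧ HasCompactSupport (fun y ↦ θ y ![a]) ∧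
      ∀ y b, fderiv ℝ θ y b ![a] = fderiv ℝ (fun y ↦ θ y ![a]) y b := by
    let L := ContinuousAlternatingMap.apply ℝ E ℝ (ι := Fin 1) ![a]
    refine ⟨L.contDiff.comp hθ, hc.comp_left (g := L) (map_zero L), fun y b ↦ ?_⟩
    have := (L.hasFDerivAt.comp y (hθ.differentiable one_ne_zero y).hasFDerivAt).fderiv
    change _ = fderiv ℝ (L ∘ θ) y b
    rw [this]
    rfl
  have hi (a b : E) : Integrable (fun y ↦ fderiv ℝ (fun y ↦ θ y ![a]) y b) μ :=
    (((key a).1.continuous_fderiv one_ne_zero).clm_apply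
      continuous_const).integrable_of_hasCompactSupport ((key a).2.1.fderiv_apply ℝ b)
  simp_rw [extDeriv_one_form_apply, (key _).2.2]
  rw [integral_sub (hi _ _) (hi _ _), integral_fderiv_apply_eq_zero (key _).1 (key _).2.1,
    integral_fderiv_apply_eq_zero (key _).1 (key _).2.1, sub_zero]

/-! ### Two-forms on the plane -/

theorem plane_eq_sum (u : Plane) : u = u 0 • stdVec 0 + u 1 • stdVec 1 := by
  ext i; fin_cases i <;> simp [stdVec]

theorem two_form_apply (w : Plane [⋀^Fin 2]→L[ℝ] ℝ) (u v : Plane) :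
    w ![u, v] = (u 0 * v 1 - u 1 * v 0) * w ![stdVec 0, stdVec 1] := by
  have u0 (x y z : Plane) : Function.update ![x, y] 0 z = ![z, y] := by
    funext i; fin_cases i <;> rfl
  have u1 (x y z : Plane) : Function.update ![x, y] 1 z = ![x, z] := by
    funext i; fin_cases i <;> rfl
  have hadd1 (a b c : Plane) : w ![a + b, c] = w ![a, c] + w ![b, c] := by
    simpa only [u0] using w.map_update_add ![a, c] 0 a b
  have hadd2 (a b c : Plane) : w ![a, b + c] = w ![a, b] + w ![a, c] := by
    simpa only [u1] using w.map_update_add ![a, b] 1 b c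
  have hs1 (t : ℝ) (a b : Plane) : w ![t • a, b] = t * w ![a, b] := by
    simpa only [u0, smul_eq_mul] using w.map_update_smul ![a, b] 0 t a
  have hs2 (t : ℝ) (a b : Plane) : w ![a, t • b] = t * w ![a, b] := by
    simpa only [u1, smul_eq_mul] using w.map_update_smul ![a, b] 1 t b
  have h0 (a : Plane) : w ![a, a] = 0 :=
    w.map_eq_zero_of_eq ![a, a] (i := 0) (j := 1) rfl (by decide)
  have hswap : w ![stdVec 1, stdVec 0] = - w ![stdVec 0, stdVec 1] := by
    have := h0 (stdVec 0 + stdVec 1)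
    rw [hadd1, hadd2, hadd2, h0, h0] at this
    linarith
  conv_lhs => rw [plane_eq_sum u, plane_eq_sum v]
  rw [hadd1, hadd2, hadd2]
  simp only [hs1, hs2, h0, hswap]
  ring

theorem two_form_eq_zero {w : Plane [⋀^Fin 2]→L[ℝ] ℝ} (h : w ![stdVec 0, stdVec 1] = 0) :
    w = 0 := by
  ext x
  have : x = ![x 0, x 1] := by ext i; fin_cases i <;> rfl
  rw [this, two_form_apply, h]
  simp

theorem wedge_apply (α β : Plane →L[ℝ] ℝ) (u v : Plane) :
    α u * β v - α v * β u = (u 0 * v 1 - u 1 * v 0) *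
      (α (stdVec 0) * β (stdVec 1) - α (stdVec 1) * β (stdVec 0)) := by
  conv_lhs => rw [plane_eq_sum u, plane_eq_sum v]
  simp only [map_add, map_smul, smul_eq_mul]
  ring

theorem det_plane (A : Plane →L[ℝ] Plane) :
    A.det = A (stdVec 0) 0 * A (stdVec 1) 1 - A (stdVec 0) 1 * A (stdVec 1) 0 := by
  rw [ContinuousLinearMap.det,
    ← LinearMap.det_toMatrix (EuclideanSpace.basisFun (Fin 2) ℝ).toBasis, Matrix.det_fin_two]
  simp [LinearMap.toMatrix_apply, stdVec]
  ring

theorem two_form_map (w : Plane [⋀^Fin 2]→L[ℝ] ℝ) (A : Plane →L[ℝ] Plane) :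
    w ![A (stdVec 0), A (stdVec 1)] = A.det * w ![stdVec 0, stdVec 1] := by
  rw [two_form_apply, det_plane]


/-! ### Chart transitions and the density of a two-form -/

section ClosedSurface

variable {S : Type*} [TopologicalSpace S] [ChartedSpace Plane S]

/-- The coefficient of a two-form in the chart at `c`. -/
noncomputable def formCoeff (Ω : (s : S) → TangentSpace (𝓡 2) s [⋀^Fin 2]→L[ℝ] ℝ) (c : S)
    (y : Plane) : ℝ :=
  formInChart (𝓡 2) Ω c y ![stdVec 0, stdVec 1]

theorem formInChart_two_apply (Ω : (s : S) → TangentSpace (𝓡 2) s [⋀^Fin 2]→L[ℝ] ℝ) (c : S)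
    (y u v : Plane) :
    formInChart (𝓡 2) Ω c y ![u, v] = Ω ((extChartAt (𝓡 2) c).symm y)
      ![mfderiv 𝓘(ℝ, Plane) (𝓡 2) (extChartAt (𝓡 2) c).symm y u,
        mfderiv 𝓘(ℝ, Plane) (𝓡 2) (extChartAt (𝓡 2) c).symm y v] := by
  change Ω ((extChartAt (𝓡 2) c).symm y) _ = _
  congr 1
  funext i; fin_cases i <;> rfl

theorem formInChart_one_apply (η : (s : S) → TangentSpace (𝓡 2) s [⋀^Fin 1]→L[ℝ] ℝ) (c : S)
    (y u : Plane) :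
    formInChart (𝓡 2) η c y ![u] = η ((extChartAt (𝓡 2) c).symm y)
      ![mfderiv 𝓘(ℝ, Plane) (𝓡 2) (extChartAt (𝓡 2) c).symm y u] := by
  change η ((extChartAt (𝓡 2) c).symm y) _ = _
  congr 1
  funext i; fin_cases i; rfl

/-- The part of the target of the chart at `c` on which the chart at `d` is defined. -/
def overlap (c d : S) : Set Plane :=
  (extChartAt (𝓡 2) c).target ∩ (extChartAt (𝓡 2) c).symm ⁻¹' (extChartAt (𝓡 2) d).source

/-- The transition map from the chart at `c` to the chart at `d`. -/
noncomputable def transition (c d : S) (y : Plane) : Plane :=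
  extChartAt (𝓡 2) d ((extChartAt (𝓡 2) c).symm y)

theorem isOpen_overlap (c d : S) : IsOpen (overlap c d) :=
  (continuousOn_extChartAt_symm c).isOpen_inter_preimage (isOpen_extChartAt_target c)
    (isOpen_extChartAt_source d)

theorem symm_transition {c d : S} {y : Plane} (hy : y ∈ overlap c d) :
    (extChartAt (𝓡 2) d).symm (transition c d y) = (extChartAt (𝓡 2) c).symm y :=
  (extChartAt (𝓡 2) d).left_inv hy.2

theorem transition_mem_overlap {c d : S} {y : Plane} (hy : y ∈ overlap c d) :
    transition c d y ∈ overlap d c := by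
  refine ⟨(extChartAt (𝓡 2) d).map_source hy.2, ?_⟩
  rw [mem_preimage, symm_transition hy]
  exact (extChartAt (𝓡 2) c).map_target hy.1

theorem transition_transition {c d : S} {y : Plane} (hy : y ∈ overlap c d) :
    transition d c (transition c d y) = y := by
  rw [transition, symm_transition hy]
  exact (extChartAt (𝓡 2) c).right_inv hy.1

theorem image_transition (c d : S) : transition c d '' overlap c d = overlap d c := by
  ext y
  constructor
  · rintro ⟨z, hz, rfl⟩
    exact transition_mem_overlap hz
  · exact fun hy ↦ ⟨_, transition_mem_overlap hy, transition_transition hy⟩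

theorem injOn_transition (c d : S) : InjOn (transition c d) (overlap c d) := by
  intro y hy z hz h
  rw [← transition_transition hy, h, transition_transition hz]

variable [IsManifold (𝓡 2) ∞ S]

theorem mdifferentiableAt_chartSymm (c : S) {y : Plane} (hy : y ∈ (extChartAt (𝓡 2) c).target) :
    MDifferentiableAt 𝓘(ℝ, Plane) (𝓡 2) (extChartAt (𝓡 2) c).symm y :=
  ((contMDiffOn_extChartAt_symm (I := 𝓡 2) (n := ∞) c).contMDiffAt
    ((isOpen_extChartAt_target c).mem_nhds hy)).mdifferentiableAt (by simp)

/-- A function supported in a chart domain, times a function on the chart target, extended by zero,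
is smooth and compactly supported. -/
theorem contDiff_indicator_smul [CompactSpace S] (c : S) {n : ℕ∞} {F : Type*}
    [NormedAddCommGroup F] [NormedSpace ℝ F] {r : S → ℝ} (hr : ContMDiff (𝓡 2) 𝓘(ℝ, ℝ) ∞ r)
    (hs : tsupport r ⊆ (extChartAt (𝓡 2) c).source) {q : Plane → F}
    (hq : ContDiffOn ℝ n q (extChartAt (𝓡 2) c).target) :
    ContDiff ℝ n ((extChartAt (𝓡 2) c).target.indicator
      fun y ↦ r ((extChartAt (𝓡 2) c).symm y) • q y) ∧
    HasCompactSupport ((extChartAt (𝓡 2) c).target.indicator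
      fun y ↦ r ((extChartAt (𝓡 2) c).symm y) • q y) ∧
    tsupport ((extChartAt (𝓡 2) c).target.indicator
      fun y ↦ r ((extChartAt (𝓡 2) c).symm y) • q y) ⊆ (extChartAt (𝓡 2) c).target := by
  set φ := extChartAt (𝓡 2) c with hφ
  have hU : IsOpen φ.target := isOpen_extChartAt_target c
  -- The function vanishes off this compact subset of the open chart target, so the extension by
  -- zero is also smooth at the boundary of the target.
  have hK : IsCompact (φ '' tsupport r) :=
    (isClosed_tsupport r).isCompact.image_of_continuousOn ((continuousOn_extChartAt c).mono hs)
  have hzero : ∀ y ∉ φ '' tsupport r,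
      φ.target.indicator (fun y ↦ r (φ.symm y) • q y) y = 0 := by
    intro y hy
    by_cases hyU : y ∈ φ.target
    · rw [indicator_of_mem hyU]
      have : φ.symm y ∉ tsupport r := fun h ↦ hy ⟨_, h, φ.right_inv hyU⟩
      simp [image_eq_zero_of_notMem_tsupport this]
    · exact indicator_of_notMem hyU _
  refine ⟨contDiff_iff_contDiffAt.2 fun y ↦ ?_, HasCompactSupport.intro hK hzero,
    (closure_minimal (fun y hy ↦ by_contra fun h ↦ (Function.mem_support.1 hy) (hzero y h))
      hK.isClosed).trans
      ((image_mono hs).trans φ.image_source_eq_target.subset)⟩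
  by_cases hyU : y ∈ φ.target
  · have h1 : ContDiffAt ℝ n (fun y ↦ r (φ.symm y)) y := by
      have h2 : ContMDiffOn 𝓘(ℝ, Plane) 𝓘(ℝ, ℝ) ∞ (fun y ↦ r (φ.symm y)) φ.target :=
        hr.comp_contMDiffOn (contMDiffOn_extChartAt_symm c)
      exact (((contMDiffOn_iff_contDiffOn.1 h2).contDiffAt (hU.mem_nhds hyU))).of_le
        (by exact_mod_cast le_top)
    refine (h1.smul (hq.contDiffAt (hU.mem_nhds hyU))).congr_of_eventuallyEq ?_
    filter_upwards [hU.mem_nhds hyU] with z hz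
    exact indicator_of_mem hz _
  · refine (contDiffAt_const (c := (0 : F))).congr_of_eventuallyEq ?_
    have : y ∉ φ '' tsupport r := by
      rintro ⟨s, hs', rfl⟩
      exact hyU (φ.map_source (hs hs'))
    filter_upwards [hK.isClosed.isOpen_compl.mem_nhds this] with z hz using hzero z hz

theorem formCoeff_ne_zero {Ω : (s : S) → TangentSpace (𝓡 2) s [⋀^Fin 2]→L[ℝ] ℝ}
    (c : S) {y : Plane} (hy : y ∈ (extChartAt (𝓡 2) c).target)
    (h : Ω ((extChartAt (𝓡 2) c).symm y) ≠ 0) : formCoeff Ω c y ≠ 0 := by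
  intro h0
  apply h
  have h1 : formInChart (𝓡 2) Ω c y = 0 := two_form_eq_zero h0
  have hinv : (mfderiv 𝓘(ℝ, Plane) (𝓡 2) (extChartAt (𝓡 2) c).symm y :
      Plane →L[ℝ] Plane).IsInvertible := by
    have := isInvertible_mfderivWithin_extChartAt_symm (I := 𝓡 2) hy
    rwa [ModelWithCorners.range_eq_univ, mfderivWithin_univ] at this
  obtain ⟨e, he⟩ := hinv
  refine two_form_eq_zero (w := (Ω ((extChartAt (𝓡 2) c).symm y) : Plane [⋀^Fin 2]→L[ℝ] ℝ)) ?_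
  have h2 := formInChart_two_apply Ω c y (e.symm (stdVec 0)) (e.symm (stdVec 1))
  rw [h1] at h2
  have h3 (u : Plane) : (mfderiv 𝓘(ℝ, Plane) (𝓡 2) (extChartAt (𝓡 2) c).symm y :
      Plane →L[ℝ] Plane) (e.symm u) = u := by
    rw [← he]; exact e.apply_symm_apply u
  erw [h3, h3] at h2
  exact h2.symm

theorem differentiableAt_transition {c d : S} {y : Plane} (hy : y ∈ overlap c d) :
    DifferentiableAt ℝ (transition c d) y := by
  have h1 := mdifferentiableAt_chartSymm c hy.1
  have h2 : MDifferentiableAt (𝓡 2) 𝓘(ℝ, Plane) (extChartAt (𝓡 2) d)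
      ((extChartAt (𝓡 2) c).symm y) :=
    mdifferentiableAt_extChartAt (by simpa using hy.2)
  exact (h2.comp y h1).differentiableAt

theorem mfderiv_symm_transition {c d : S} {y : Plane} (hy : y ∈ overlap c d) (u : Plane) :
    (mfderiv 𝓘(ℝ, Plane) (𝓡 2) (extChartAt (𝓡 2) c).symm y u : Plane) =
      mfderiv 𝓘(ℝ, Plane) (𝓡 2) (extChartAt (𝓡 2) d).symm (transition c d y)
        (fderiv ℝ (transition c d) y u) := by
  have h1 := mdifferentiableAt_chartSymm d (transition_mem_overlap hy).1
  have h2 := (differentiableAt_transition hy).mdifferentiableAt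
  have h3 := mfderiv_comp y h1 h2
  have h4 : (extChartAt (𝓡 2) c).symm =ᶠ[𝓝 y] (extChartAt (𝓡 2) d).symm ∘ transition c d := by
    filter_upwards [(isOpen_overlap c d).mem_nhds hy] with z hz
    exact (symm_transition hz).symm
  rw [h4.mfderiv_eq, h3, mfderiv_eq_fderiv]
  rfl

/-- The Jacobian determinant appears here with its sign. After taking absolute values this is the
factor of the change of variables formula, so `|Ω|` can be integrated without an orientation. -/
theorem formCoeff_transition (Ω : (s : S) → TangentSpace (𝓡 2) s [⋀^Fin 2]→L[ℝ] ℝ) {c d : S}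
    {y : Plane} (hy : y ∈ overlap c d) :
    formCoeff Ω c y =
      (fderiv ℝ (transition c d) y).det * formCoeff Ω d (transition c d y) := by
  rw [formCoeff, formCoeff, ← two_form_map, formInChart_two_apply, formInChart_two_apply,
    symm_transition hy]
  congr 1
  funext i; fin_cases i <;> exact mfderiv_symm_transition hy _

/-- The integral of a function against the density of a two-form, in two charts. -/
theorem integral_density_change_of_chart
    (Ω : (s : S) → TangentSpace (𝓡 2) s [⋀^Fin 2]→L[ℝ] ℝ) (c d : S)
    {h : S → ℝ} (hc : ∀ s ∉ (extChartAt (𝓡 2) c).source, h s = 0)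
    (hd : ∀ s ∉ (extChartAt (𝓡 2) d).source, h s = 0) :
    (IntegrableOn (fun y ↦ |formCoeff Ω c y| * h ((extChartAt (𝓡 2) c).symm y))
      (extChartAt (𝓡 2) c).target →
    IntegrableOn (fun y ↦ |formCoeff Ω d y| * h ((extChartAt (𝓡 2) d).symm y))
      (extChartAt (𝓡 2) d).target) ∧
    ∫ y in (extChartAt (𝓡 2) c).target,
      |formCoeff Ω c y| * h ((extChartAt (𝓡 2) c).symm y) =
    ∫ y in (extChartAt (𝓡 2) d).target,
      |formCoeff Ω d y| * h ((extChartAt (𝓡 2) d).symm y) := by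
  -- As `h` vanishes off both chart domains, each integral reduces to one over the overlap.
  have hzc : ∀ y ∈ (extChartAt (𝓡 2) c).target \ overlap c d,
      |formCoeff Ω c y| * h ((extChartAt (𝓡 2) c).symm y) = 0 := fun y hy ↦ by
    rw [hd _ fun hs ↦ hy.2 ⟨hy.1, hs⟩, mul_zero]
  have hzd : ∀ y ∈ (extChartAt (𝓡 2) d).target \ overlap d c,
      |formCoeff Ω d y| * h ((extChartAt (𝓡 2) d).symm y) = 0 := fun y hy ↦ by
    rw [hc _ fun hs ↦ hy.2 ⟨hy.1, hs⟩, mul_zero]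
  have hm := (isOpen_overlap c d).measurableSet
  have hder : ∀ y ∈ overlap c d, HasFDerivWithinAt (transition c d)
      (fderiv ℝ (transition c d) y) (overlap c d) y := fun y hy ↦
    (differentiableAt_transition hy).hasFDerivAt.hasFDerivWithinAt
  have heq : EqOn (fun y ↦ |(fderiv ℝ (transition c d) y).det| •
      (|formCoeff Ω d (transition c d y)| *
        h ((extChartAt (𝓡 2) d).symm (transition c d y))))
      (fun y ↦ |formCoeff Ω c y| * h ((extChartAt (𝓡 2) c).symm y)) (overlap c d) := by
    intro y hy
    simp only [smul_eq_mul]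
    rw [formCoeff_transition Ω hy, symm_transition hy, abs_mul, mul_assoc]
  constructor
  · intro hi
    have h1 := hi.mono_set (inter_subset_left : overlap c d ⊆ _)
    have h2 := (integrableOn_congr_fun heq hm).2 h1
    have h3 := (integrableOn_image_iff_integrableOn_abs_det_fderiv_smul volume hm hder
      (injOn_transition c d)
      (fun y ↦ |formCoeff Ω d y| * h ((extChartAt (𝓡 2) d).symm y))).2 h2
    rw [image_transition] at h3
    exact h3.of_forall_sdiff_eq_zero (isOpen_extChartAt_target d).measurableSet hzd
  · have h3 := integral_image_eq_integral_abs_det_fderiv_smul volume hm hder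
      (injOn_transition c d)
      (fun y ↦ |formCoeff Ω d y| * h ((extChartAt (𝓡 2) d).symm y))
    rw [image_transition, setIntegral_congr_fun hm heq] at h3
    rw [setIntegral_eq_of_subset_of_forall_sdiff_eq_zero
      (isOpen_extChartAt_target c).measurableSet inter_subset_left hzc,
      setIntegral_eq_of_subset_of_forall_sdiff_eq_zero
      (isOpen_extChartAt_target d).measurableSet inter_subset_left hzd]
    exact h3.symm

end ClosedSurface


/-! ### The quotient of `d(rη)` by `Ω` and its integral in a chart -/

section ClosedSurface

variable {S : Type*} [TopologicalSpace S] [ChartedSpace Plane S]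

/-- The differential of a function on a surface, as a linear form. -/
noncomputable def differential (r : S → ℝ) (s : S) : Plane →L[ℝ] ℝ :=
  mfderiv (𝓡 2) 𝓘(ℝ, ℝ) r s

/-- The quotient of the two-form `dr ∧ η` by the two-form `Ω`. -/
noncomputable def wedgeRatio (η : (s : S) → TangentSpace (𝓡 2) s [⋀^Fin 1]→L[ℝ] ℝ)
    (Ω : (s : S) → TangentSpace (𝓡 2) s [⋀^Fin 2]→L[ℝ] ℝ) (r : S → ℝ) (s : S) : ℝ :=
  -- Every tangent space is by definition a copy of `Plane`. Where `Ω` is nonzero the quotient does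
  -- not depend on the basis used, so the standard one serves.
  let α : Plane [⋀^Fin 1]→L[ℝ] ℝ := η s
  let β : Plane [⋀^Fin 2]→L[ℝ] ℝ := Ω s
  (differential r s (stdVec 0) * α ![stdVec 1] - differential r s (stdVec 1) * α ![stdVec 0]) /
    β ![stdVec 0, stdVec 1]

theorem wedgeRatio_eq_zero {η : (s : S) → TangentSpace (𝓡 2) s [⋀^Fin 1]→L[ℝ] ℝ}
    {Ω : (s : S) → TangentSpace (𝓡 2) s [⋀^Fin 2]→L[ℝ] ℝ} {r : S → ℝ} {s : S}
    (hs : s ∉ tsupport r) : wedgeRatio η Ω r s = 0 := by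
  have h : r =ᶠ[𝓝 s] fun _ ↦ (0 : ℝ) := notMem_tsupport_iff_eventuallyEq.1 hs
  have h2 : differential r s = 0 := h.mfderiv_eq.trans mfderiv_const
  simp [wedgeRatio, h2]

/-- The differentials of functions with constant sum add up to zero, and the quotient is linear in
`dr`. -/
theorem sum_wedgeRatio (η : (s : S) → TangentSpace (𝓡 2) s [⋀^Fin 1]→L[ℝ] ℝ)
    (Ω : (s : S) → TangentSpace (𝓡 2) s [⋀^Fin 2]→L[ℝ] ℝ) {ι : Type*} (T : Finset ι)
    {r : ι → S → ℝ} (hr : ∀ i, MDifferentiable (𝓡 2) 𝓘(ℝ, ℝ) (r i))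
    (hsum : ∀ s, ∑ i ∈ T, r i s = 1) (s : S) : ∑ i ∈ T, wedgeRatio η Ω (r i) s = 0 := by
  have h0 (R : Finset ι) : MDifferentiable (𝓡 2) 𝓘(ℝ, ℝ) (∑ i ∈ R, r i) ∧
      differential (∑ i ∈ R, r i) s = ∑ i ∈ R, differential (r i) s := by
    classical
    induction R using Finset.induction_on with
    | empty => exact ⟨mdifferentiable_const (c := (0 : ℝ)), mfderiv_const (c := (0 : ℝ))⟩
    | insert a R ha ih =>
      rw [Finset.sum_insert ha, Finset.sum_insert ha, ← ih.2]
      exact ⟨(hr a).add ih.1, ((hr a s).hasMFDerivAt.add (ih.1 s).hasMFDerivAt).mfderiv⟩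
  have h1 := (h0 T).2
  have h2 : ∑ i ∈ T, differential (r i) s = 0 := by
    have h3 : (∑ i ∈ T, r i) = fun _ ↦ (1 : ℝ) := by
      funext s; rw [Finset.sum_apply, hsum]
    rw [h3] at h1
    exact h1.symm.trans mfderiv_const
  have h4 (u : Plane) : ∑ i ∈ T, differential (r i) s u = 0 := by
    rw [← sum_apply, h2]; rfl
  unfold wedgeRatio
  simp only
  rw [← Finset.sum_div, Finset.sum_sub_distrib, ← Finset.sum_mul, ← Finset.sum_mul, h4, h4]
  simp

/-- A one-form as a linear form. -/
noncomputable def oneFormToLinear (α : Plane [⋀^Fin 1]→L[ℝ] ℝ) : Plane →L[ℝ] ℝ :=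
  (ContinuousAlternatingMap.ofSubsingleton ℝ Plane ℝ (0 : Fin 1)).symm α

theorem oneFormToLinear_apply (α : Plane [⋀^Fin 1]→L[ℝ] ℝ) (u : Plane) :
    oneFormToLinear α u = α ![u] := by
  change α _ = α _
  congr 1
  funext i; fin_cases i; rfl

variable [IsManifold (𝓡 2) ∞ S]

/-- Leibniz: `d(rη) = r dη + dr ∧ η`, with `dη = Ω`, and `dr ∧ η` is a multiple of `Ω` because
two-forms on a plane are proportional. The chart multiplies both by the same determinant, which
cancels in the quotient. -/
theorem extDeriv_smul_formInChart {η : (s : S) → TangentSpace (𝓡 2) s [⋀^Fin 1]→L[ℝ] ℝ}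
    {Ω : (s : S) → TangentSpace (𝓡 2) s [⋀^Fin 2]→L[ℝ] ℝ} {r : S → ℝ}
    (hr : ContMDiff (𝓡 2) 𝓘(ℝ, ℝ) ∞ r) {c : S} {y : Plane}
    (hy : y ∈ (extChartAt (𝓡 2) c).target)
    (hη : DifferentiableAt ℝ (formInChart (𝓡 2) η c) y)
    (hd : extDeriv (formInChart (𝓡 2) η c) y = formInChart (𝓡 2) Ω c y)
    (hΩ : Ω ((extChartAt (𝓡 2) c).symm y) ≠ 0) :
    extDeriv (fun z ↦ r ((extChartAt (𝓡 2) c).symm z) • formInChart (𝓡 2) η c z) y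
      ![stdVec 0, stdVec 1] =
    (r ((extChartAt (𝓡 2) c).symm y) + wedgeRatio η Ω r ((extChartAt (𝓡 2) c).symm y)) *
      formCoeff Ω c y := by
  have h1 := mdifferentiableAt_chartSymm c hy
  have h2 : MDifferentiableAt (𝓡 2) 𝓘(ℝ, ℝ) r ((extChartAt (𝓡 2) c).symm y) :=
    hr.mdifferentiable (by simp) _
  have h3 : DifferentiableAt ℝ (fun z ↦ r ((extChartAt (𝓡 2) c).symm z)) y :=
    (h2.comp y h1).differentiableAt
  rw [extDeriv_smul_one_form_apply h3 hη, hd, ← formCoeff, add_mul]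
  congr 1
  set s := (extChartAt (𝓡 2) c).symm y with hs
  let dr : Plane →L[ℝ] ℝ := differential r s
  let α : Plane [⋀^Fin 1]→L[ℝ] ℝ := η s
  let β : Plane [⋀^Fin 2]→L[ℝ] ℝ := Ω s
  let A : Plane →L[ℝ] Plane := mfderiv 𝓘(ℝ, Plane) (𝓡 2) (extChartAt (𝓡 2) c).symm y
  have hβ : β ![stdVec 0, stdVec 1] ≠ 0 := fun h ↦ hΩ (two_form_eq_zero (w := β) h)
  have h4 (u : Plane) : fderiv ℝ (fun z ↦ r ((extChartAt (𝓡 2) c).symm z)) y u = dr (A u) := by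
    have := mfderiv_comp y h2 h1
    rw [mfderiv_eq_fderiv] at this
    exact DFunLike.congr_fun this u
  have h5 (u : Plane) : formInChart (𝓡 2) η c y ![u] = oneFormToLinear α (A u) := by
    rw [oneFormToLinear_apply]
    exact formInChart_one_apply η c y u
  have h6 : formCoeff Ω c y = β ![A (stdVec 0), A (stdVec 1)] := formInChart_two_apply Ω c y _ _
  have h7 : wedgeRatio η Ω r s = (dr (stdVec 0) * oneFormToLinear α (stdVec 1) -
      dr (stdVec 1) * oneFormToLinear α (stdVec 0)) / β ![stdVec 0, stdVec 1] := by
    rw [oneFormToLinear_apply, oneFormToLinear_apply]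
    rfl
  rw [h4, h4, h5, h5, h6, h7, wedge_apply, two_form_apply β (A _)]
  field_simp

/-- In a chart, the density `|Ω|` times the quotient of `d(rη)` by `Ω = dη` has integral zero. -/
theorem integral_density_eq_zero [CompactSpace S]
    {η : (s : S) → TangentSpace (𝓡 2) s [⋀^Fin 1]→L[ℝ] ℝ}
    {Ω : (s : S) → TangentSpace (𝓡 2) s [⋀^Fin 2]→L[ℝ] ℝ} (c : S)
    (hη : ContDiffOn ℝ 1 (formInChart (𝓡 2) η c) (extChartAt (𝓡 2) c).target)
    (hd : ∀ y ∈ (extChartAt (𝓡 2) c).target,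
      extDeriv (formInChart (𝓡 2) η c) y = formInChart (𝓡 2) Ω c y)
    (hΩ : ∀ s, Ω s ≠ 0) (hcont : ContinuousOn (formCoeff Ω c) (extChartAt (𝓡 2) c).target)
    {r : S → ℝ} (hr : ContMDiff (𝓡 2) 𝓘(ℝ, ℝ) ∞ r)
    (hs : tsupport r ⊆ (extChartAt (𝓡 2) c).source) :
    IntegrableOn (fun y ↦ |formCoeff Ω c y| * (r ((extChartAt (𝓡 2) c).symm y) +
      wedgeRatio η Ω r ((extChartAt (𝓡 2) c).symm y))) (extChartAt (𝓡 2) c).target ∧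
    ∫ y in (extChartAt (𝓡 2) c).target, |formCoeff Ω c y| *
      (r ((extChartAt (𝓡 2) c).symm y) +
        wedgeRatio η Ω r ((extChartAt (𝓡 2) c).symm y)) = 0 := by
  set φ := extChartAt (𝓡 2) c with hφ
  have hU : IsOpen φ.target := isOpen_extChartAt_target c
  have hne : ∀ y ∈ φ.target, formCoeff Ω c y ≠ 0 := fun y hy ↦ formCoeff_ne_zero c hy (hΩ _)
  -- Multiplying by the sign of the coefficient turns `Ω` into `|Ω|`. The coefficient is continuous
  -- without zeros on the target, so the sign is locally constant and commutes with differentiation.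
  let σ : Plane → ℝ := fun y ↦ SignType.sign (formCoeff Ω c y)
  have hσ : ∀ y ∈ φ.target, ∀ᶠ z in 𝓝 y, σ z = σ y := by
    intro y hy
    have hc : ContinuousAt (formCoeff Ω c) y := hcont.continuousAt (hU.mem_nhds hy)
    rcases lt_or_gt_of_ne (hne y hy) with h | h
    · filter_upwards [hc.eventually_lt_const h] with z hz
      simp [σ, sign_neg hz, sign_neg h]
    · filter_upwards [hc.eventually_const_lt h] with z hz
      simp [σ, sign_pos hz, sign_pos h]
  have hσc : ContDiffOn ℝ 1 (fun y ↦ σ y • formInChart (𝓡 2) η c y) φ.target := by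
    intro y hy
    refine ContDiffAt.contDiffWithinAt ?_
    refine ((hη.contDiffAt (hU.mem_nhds hy)).const_smul (σ y)).congr_of_eventuallyEq ?_
    filter_upwards [hσ y hy] with z hz
    rw [hz]
  -- The form `σ r η`, extended by zero, is a compactly supported one-form on the whole plane, so
  -- Stokes applies to it.
  obtain ⟨hV, hVc, hVt⟩ := contDiff_indicator_smul c (n := 1) hr hs (by exact_mod_cast hσc)
  set V := φ.target.indicator fun y ↦ r (φ.symm y) • σ y • formInChart (𝓡 2) η c y with hVdef
  have hV' : ContDiff ℝ 1 V := by exact_mod_cast hV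
  have hint := integral_extDeriv_eq_zero (μ := volume) hV' hVc (stdVec 0) (stdVec 1)
  have hzero : ∀ y ∉ φ.target, extDeriv V y ![stdVec 0, stdVec 1] = 0 := by
    intro y hy
    have hy' : y ∉ tsupport V := fun h ↦ hy (hVt h)
    rw [extDeriv_one_form_apply, fderiv_of_notMem_tsupport ℝ hy']
    simp
  have heq : ∀ y ∈ φ.target, extDeriv V y ![stdVec 0, stdVec 1] =
      |formCoeff Ω c y| * (r (φ.symm y) + wedgeRatio η Ω r (φ.symm y)) := by
    intro y hy
    have h1 : V =ᶠ[𝓝 y] σ y • fun z ↦ r (φ.symm z) • formInChart (𝓡 2) η c z := by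
      filter_upwards [hσ y hy, hU.mem_nhds hy] with z hz hzU
      rw [hVdef, indicator_of_mem hzU, hz, Pi.smul_apply, smul_comm]
    have h2 : DifferentiableAt ℝ (formInChart (𝓡 2) η c) y :=
      (hη.contDiffAt (hU.mem_nhds hy)).differentiableAt one_ne_zero
    rw [h1.extDeriv_eq, extDeriv_smul, ContinuousAlternatingMap.smul_apply,
      extDeriv_smul_formInChart hr hy h2 (hd y hy) (hΩ _), smul_eq_mul, ← sign_mul_self]
    ring
  constructor
  · have hi : Integrable (fun y ↦ extDeriv V y ![stdVec 0, stdVec 1]) := by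
      refine Continuous.integrable_of_hasCompactSupport ?_ ?_
      · simp_rw [extDeriv_one_form_apply]
        have := hV'.continuous_fderiv one_ne_zero
        have hL (a : Plane) : Continuous fun θ : Plane [⋀^Fin 1]→L[ℝ] ℝ ↦ θ ![a] :=
          (ContinuousAlternatingMap.apply ℝ Plane ℝ (ι := Fin 1) ![a]).continuous
        exact ((hL _).comp (this.clm_apply continuous_const)).sub
          ((hL _).comp (this.clm_apply continuous_const))
      · refine HasCompactSupport.intro (hVc.fderiv ℝ) fun y hy ↦ ?_
        rw [extDeriv_one_form_apply, image_eq_zero_of_notMem_tsupport hy]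
        simp
    exact (integrableOn_congr_fun heq hU.measurableSet).1 hi.integrableOn
  · rw [← setIntegral_congr_fun hU.measurableSet heq,
      setIntegral_eq_integral_of_forall_compl_eq_zero hzero, hint]

end ClosedSurface


/-! ### Exact two-forms on closed surfaces -/

/-- An exact two-form on a closed surface vanishes somewhere. -/
theorem exists_eq_zero_of_exact {S : Type*} [TopologicalSpace S] [ChartedSpace Plane S]
    [IsManifold (𝓡 2) ∞ S] [CompactSpace S] [T2Space S] [Nonempty S]
    {η : (s : S) → TangentSpace (𝓡 2) s [⋀^Fin 1]→L[ℝ] ℝ}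
    {Ω : (s : S) → TangentSpace (𝓡 2) s [⋀^Fin 2]→L[ℝ] ℝ}
    (hη : ∀ c, ContDiffOn ℝ 1 (formInChart (𝓡 2) η c) (extChartAt (𝓡 2) c).target)
    (hd : ∀ c, ∀ y ∈ (extChartAt (𝓡 2) c).target,
      extDeriv (formInChart (𝓡 2) η c) y = formInChart (𝓡 2) Ω c y) :
    ∃ s, Ω s = 0 := by
  by_contra! hΩ
  -- Continuity of `Ω` is not assumed; it comes from `Ω = dη` with `η` of class `C¹`.
  have hcont (c : S) : ContinuousOn (formCoeff Ω c) (extChartAt (𝓡 2) c).target := by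
    have h1 : ContinuousOn (fderiv ℝ (formInChart (𝓡 2) η c)) (extChartAt (𝓡 2) c).target :=
      (hη c).continuousOn_fderiv_of_isOpen (isOpen_extChartAt_target c) le_rfl
    have hL (a : Plane) : Continuous fun θ : Plane [⋀^Fin 1]→L[ℝ] ℝ ↦ θ ![a] :=
      (ContinuousAlternatingMap.apply ℝ Plane ℝ (ι := Fin 1) ![a]).continuous
    have h2 (u a : Plane) : ContinuousOn
        (fun y ↦ fderiv ℝ (formInChart (𝓡 2) η c) y u ![a]) (extChartAt (𝓡 2) c).target :=
      (hL a).comp_continuousOn (h1.clm_apply continuousOn_const)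
    refine ((h2 (stdVec 0) (stdVec 1)).sub (h2 (stdVec 1) (stdVec 0))).congr fun y hy ↦ ?_
    rw [formCoeff, ← hd c y hy, extDeriv_one_form_apply]
    rfl
  obtain ⟨ρ, hρ⟩ := SmoothPartitionOfUnity.exists_isSubordinate_chartAt_source (𝓡 2) S
  have hsub (c : S) : tsupport (ρ c) ⊆ (extChartAt (𝓡 2) c).source := by
    simpa using hρ c
  have hfin : {c | (Function.support (ρ c)).Nonempty}.Finite :=
    ρ.locallyFinite.finite_nonempty_of_compact
  set T := hfin.toFinset with hT
  have hzero {c : S} (hc : c ∉ T) (s : S) : ρ c s = 0 := by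
    by_contra h
    exact hc (by rw [hT, Set.Finite.mem_toFinset]; exact ⟨s, h⟩)
  have hsum (s : S) : ∑ c ∈ T, ρ c s = 1 := by
    rw [← ρ.sum_eq_one (mem_univ s), finsum_eq_sum_of_support_subset]
    intro c hc
    by_contra h
    exact hc (hzero h s)
  have hsm (c : S) : ContMDiff (𝓡 2) 𝓘(ℝ, ℝ) ∞ (ρ c) := (ρ c).contMDiff
  have hρ0 {c s : S} (h : s ∉ (extChartAt (𝓡 2) c).source) : ρ c s = 0 :=
    image_eq_zero_of_notMem_tsupport fun h' ↦ h (hsub c h')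
  -- This is `d(ρ c η) / Ω`: by `hhsum` these functions add up to `1`, and by `hI` each has integral
  -- zero against `|Ω|`.
  let h (c s : S) : ℝ := ρ c s + wedgeRatio η Ω (ρ c) s
  have hh0 {c s : S} (hs : s ∉ (extChartAt (𝓡 2) c).source) : h c s = 0 := by
    simp only [h]
    rw [hρ0 hs, wedgeRatio_eq_zero fun h' ↦ hs (hsub c h'), add_zero]
  have hhsum (s : S) : ∑ c ∈ T, h c s = 1 := by
    simp only [h]
    rw [Finset.sum_add_distrib, hsum,
      sum_wedgeRatio η Ω T (fun c ↦ (hsm c).mdifferentiable (by simp)) hsum, add_zero]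
  have hI (c : S) := integral_density_eq_zero c (hη c) (hd c) hΩ (hcont c) (hsm c) (hsub c)
  have hm (c : S) : MeasurableSet (extChartAt (𝓡 2) c).target :=
    (isOpen_extChartAt_target c).measurableSet
  have hint (c d : S) : IntegrableOn (fun y ↦ |formCoeff Ω c y| *
      (ρ d ((extChartAt (𝓡 2) c).symm y) * h c ((extChartAt (𝓡 2) c).symm y)))
      (extChartAt (𝓡 2) c).target := by
    have h1 : ContinuousOn (fun y ↦ ρ d ((extChartAt (𝓡 2) c).symm y))
        (extChartAt (𝓡 2) c).target :=
      (hsm d).continuous.comp_continuousOn (continuousOn_extChartAt_symm c)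
    have h2 := (hI c).1.bdd_mul (c := 1) (h1.aestronglyMeasurable (hm c)) (ae_of_all _ fun y ↦ by
      rw [Real.norm_of_nonneg (ρ.nonneg d _)]; exact ρ.le_one d _)
    refine h2.congr (ae_of_all _ fun y ↦ ?_)
    simp only [h]
    ring
  -- The product `ρ d * h c` is supported in both chart domains, so its integral may be computed in
  -- either chart.
  have hchange (c d : S) := integral_density_change_of_chart Ω c d (h := fun s ↦ ρ d s * h c s)
    (fun s hs ↦ by rw [hh0 hs, mul_zero]) (fun s hs ↦ by rw [hρ0 hs, zero_mul])
  -- The left side is the total mass of `|Ω|`. Inserting `∑ h c = 1`, changing charts term by term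
  -- and summing the `ρ d` to `1` leaves the integrals of `h c`, which vanish.
  have htotal : ∑ d ∈ T, ∫ y in (extChartAt (𝓡 2) d).target,
      |formCoeff Ω d y| * ρ d ((extChartAt (𝓡 2) d).symm y) = 0 := by
    calc
      _ = ∑ d ∈ T, ∑ c ∈ T, ∫ y in (extChartAt (𝓡 2) d).target, |formCoeff Ω d y| *
          (ρ d ((extChartAt (𝓡 2) d).symm y) * h c ((extChartAt (𝓡 2) d).symm y)) := by
        refine Finset.sum_congr rfl fun d _ ↦ ?_
        rw [← integral_finsetSum _ fun c _ ↦ (hchange c d).1 (hint c d)]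
        refine integral_congr_ae (ae_of_all _ fun y ↦ ?_)
        simp only
        rw [← Finset.mul_sum, ← Finset.mul_sum, hhsum, mul_one]
      _ = ∑ d ∈ T, ∑ c ∈ T, ∫ y in (extChartAt (𝓡 2) c).target, |formCoeff Ω c y| *
          (ρ d ((extChartAt (𝓡 2) c).symm y) * h c ((extChartAt (𝓡 2) c).symm y)) :=
        Finset.sum_congr rfl fun d _ ↦ Finset.sum_congr rfl fun c _ ↦ (hchange c d).2.symm
      _ = ∑ c ∈ T, ∫ y in (extChartAt (𝓡 2) c).target, |formCoeff Ω c y| *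
          h c ((extChartAt (𝓡 2) c).symm y) := by
        rw [Finset.sum_comm]
        refine Finset.sum_congr rfl fun c _ ↦ ?_
        rw [← integral_finsetSum _ fun d _ ↦ hint c d]
        refine integral_congr_ae (ae_of_all _ fun y ↦ ?_)
        simp only
        rw [← Finset.mul_sum, ← Finset.sum_mul, hsum, one_mul]
      _ = 0 := Finset.sum_eq_zero fun c _ ↦ (hI c).2
  have hnonneg (d : S) : 0 ≤ ∫ y in (extChartAt (𝓡 2) d).target,
      |formCoeff Ω d y| * ρ d ((extChartAt (𝓡 2) d).symm y) :=
    integral_nonneg fun y ↦ mul_nonneg (abs_nonneg _) (ρ.nonneg d _)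
  obtain ⟨s⟩ := ‹Nonempty S›
  obtain ⟨d, hdT, hds⟩ := Finset.exists_ne_zero_of_sum_ne_zero
    ((hsum s).trans_ne one_ne_zero)
  have hpos : 0 < ∫ y in (extChartAt (𝓡 2) d).target,
      |formCoeff Ω d y| * ρ d ((extChartAt (𝓡 2) d).symm y) := by
    -- With `n = 0` this gives continuity of the integrand extended by zero; it is nonnegative and
    -- nonzero at the image of `s`.
    obtain ⟨h1, h2, -⟩ := contDiff_indicator_smul d (n := 0) (hsm d) (hsub d)
      (q := fun y ↦ |formCoeff Ω d y|) (contDiffOn_zero.2 (hcont d).abs)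
    have hs : s ∈ (extChartAt (𝓡 2) d).source := by
      by_contra hs
      exact hds (hρ0 hs)
    have h3 := h1.continuous.integral_pos_of_hasCompactSupport_nonneg_nonzero (μ := volume)
      (x := extChartAt (𝓡 2) d s) h2
      (indicator_nonneg fun y _ ↦ mul_nonneg (ρ.nonneg d _) (abs_nonneg _)) (by
        rw [indicator_of_mem ((extChartAt (𝓡 2) d).map_source hs),
          (extChartAt (𝓡 2) d).left_inv hs]
        exact mul_ne_zero hds (abs_ne_zero.2
          (formCoeff_ne_zero d ((extChartAt (𝓡 2) d).map_source hs) (hΩ _))))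
    rw [integral_indicator (hm d)] at h3
    simpa only [smul_eq_mul, mul_comm] using h3
  exact hpos.ne' ((Finset.sum_eq_zero_iff_of_nonneg fun d _ ↦ hnonneg d).1 htotal d hdT)


/-! ### The tautological form of the cotangent bundle in charts -/

/-- The tautological one-form of `E × E*`, as a linear map to the space of one-forms. -/
noncomputable def tautologicalLinear (E : Type*) [NormedAddCommGroup E] [NormedSpace ℝ E] :
    (E × (E →L[ℝ] ℝ)) →L[ℝ] ((E × (E →L[ℝ] ℝ)) [⋀^Fin 1]→L[ℝ] ℝ) :=
  ((ContinuousAlternatingMap.ofSubsingletonLIE (𝕜 := ℝ) (E := E × (E →L[ℝ] ℝ))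
    (F := ℝ) (0 : Fin 1)).toContinuousLinearEquiv :
      ((E × (E →L[ℝ] ℝ)) →L[ℝ] ℝ) →L[ℝ] _).comp
    (((ContinuousLinearMap.compL ℝ (E × (E →L[ℝ] ℝ)) E ℝ).flip
      (ContinuousLinearMap.fst ℝ E (E →L[ℝ] ℝ))).comp
        (ContinuousLinearMap.snd ℝ E (E →L[ℝ] ℝ)))

theorem extDeriv_linear_apply {E : Type*} [NormedAddCommGroup E] [NormedSpace ℝ E]
    (L : E →L[ℝ] (E [⋀^Fin 1]→L[ℝ] ℝ)) (y u v : E) :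
    extDeriv L y ![u, v] = L u ![v] - L v ![u] := by
  rw [extDeriv_one_form_apply, L.fderiv]

/-- In coordinates the tautological form is `∑ pᵢ dqᵢ`, which is linear in the base point and so is
its own derivative; the result is `∑ dpᵢ ∧ dqᵢ`. -/
theorem extDeriv_tautologicalLinear {E : Type*} [NormedAddCommGroup E] [NormedSpace ℝ E]
    (y W W' : E × (E →L[ℝ] ℝ)) :
    extDeriv (tautologicalLinear E) y ![W, W'] = W.2 W'.1 - W'.2 W.1 :=
  extDeriv_linear_apply (E := E × (E →L[ℝ] ℝ)) (tautologicalLinear E) y W W'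

theorem contDiff_tautologicalLinear {E : Type*} [NormedAddCommGroup E] [NormedSpace ℝ E] :
    ContDiff ℝ ∞ (tautologicalLinear E) :=
  ContinuousLinearMap.contDiff (𝕜 := ℝ) (E := E × (E →L[ℝ] ℝ))
    (F := (E × (E →L[ℝ] ℝ)) [⋀^Fin 1]→L[ℝ] ℝ) (tautologicalLinear E)

section Cotangent

variable {N : Type*} [TopologicalSpace N] [ChartedSpace Plane N] [IsManifold (𝓡 2) ∞ N]

theorem extChartAt_cotangent_fst (α q : CotangentBundle N) :
    (extChartAt cotangentModel α q).1 = extChartAt (𝓡 2) α.1 q.1 := by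
  rw [FiberBundle.extChartAt]; rfl

/-- The hom bundle is trivialized by precomposition with the inverse of the tangent trivialization;
the trivial bundle of values contributes the identity. -/
theorem extChartAt_cotangent_snd (α q : CotangentBundle N) (w : Plane) :
    (extChartAt cotangentModel α q).2 w =
      q.2 ((trivializationAt Plane (fun z : N ↦ TangentSpace (𝓡 2) z) α.1).symmL ℝ q.1 w) := by
  rw [FiberBundle.extChartAt]
  simp only [mfld_simps, hom_trivializationAt_apply]
  change ((trivializationAt ℝ (Bundle.Trivial N ℝ) α.1).continuousLinearMapAt ℝ q.1)
    (q.2 _) = _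
  erw [Bundle.Trivial.continuousLinearMapAt_trivialization]
  rfl

theorem mem_extChartAt_cotangent_source (α q : CotangentBundle N) :
    q ∈ (extChartAt cotangentModel α).source ↔ q.1 ∈ (chartAt Plane α.1).source := by
  rw [extChartAt_source]
  simp only [FiberBundle.chartedSpace_chartAt, mfld_simps]
  constructor
  · exact fun h ↦ h.1.1
  · intro h
    have h' : q.1 ∈ (chartAt Plane α.1).source ∧
        q.1 ∈ (trivializationAt ℝ (Bundle.Trivial N ℝ) α.1).baseSet := ⟨h, trivial⟩
    refine ⟨h', ?_⟩
    rw [Trivialization.coe_fst']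
    · exact h
    · exact h'

theorem formInChart_tautologicalForm (α : CotangentBundle N) {y : Plane × (Plane →L[ℝ] ℝ)}
    (hy : y ∈ (extChartAt cotangentModel α).target) :
    formInChart cotangentModel (tautologicalForm (N := N)) α y =
      ContinuousAlternatingMap.ofSubsingletonLIE (𝕜 := ℝ) (0 : Fin 1)
        (y.2.comp (ContinuousLinearMap.fst ℝ Plane (Plane →L[ℝ] ℝ))) := by
  set ψ := extChartAt cotangentModel α with hψ
  set φ := extChartAt (𝓡 2) α.1 with hφ
  have hopen : IsOpen ψ.target := isOpen_extChartAt_target α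
  have hfst : ∀ z ∈ ψ.target, (ψ.symm z).1 ∈ φ.source ∧ (ψ.symm z).1 = φ.symm z.1 ∧
      z.1 = φ (ψ.symm z).1 := by
    intro z hz
    have h1 : (ψ.symm z).1 ∈ φ.source := by
      rw [hφ, extChartAt_source]
      exact (mem_extChartAt_cotangent_source α _).1 (ψ.map_target hz)
    have h2 : z.1 = φ (ψ.symm z).1 := by
      rw [hφ, ← extChartAt_cotangent_fst, ← hψ, ψ.right_inv hz]
    exact ⟨h1, by rw [h2, φ.left_inv h1], h2⟩
  obtain ⟨hsrc, hsymm, hyφ⟩ := hfst y hy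
  have hyt : y.1 ∈ φ.target := hyφ ▸ φ.map_source hsrc
  have hψd : MDifferentiableAt 𝓘(ℝ, Plane × (Plane →L[ℝ] ℝ)) cotangentModel ψ.symm y :=
    ((contMDiffOn_extChartAt_symm (I := cotangentModel) (n := ∞) α).contMDiffAt
      (hopen.mem_nhds hy)).mdifferentiableAt (by simp)
  have hπd : MDifferentiableAt cotangentModel (𝓡 2) (fun β : CotangentBundle N ↦ β.1)
      (ψ.symm y) := mdifferentiableAt_proj _
  have h1 := mfderiv_comp y hπd hψd
  have h2 : (fun β : CotangentBundle N ↦ β.1) ∘ ψ.symm =ᶠ[𝓝 y] φ.symm ∘ Prod.fst := by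
    filter_upwards [hopen.mem_nhds hy] with z hz
    exact (hfst z hz).2.1
  have hφd : MDifferentiableAt 𝓘(ℝ, Plane) (𝓡 2) φ.symm y.1 := mdifferentiableAt_chartSymm _ hyt
  have hf : HasMFDerivAt 𝓘(ℝ, Plane × (Plane →L[ℝ] ℝ)) 𝓘(ℝ, Plane)
      (Prod.fst : Plane × (Plane →L[ℝ] ℝ) → Plane) y
      (ContinuousLinearMap.fst ℝ Plane (Plane →L[ℝ] ℝ)) := hasFDerivAt_fst.hasMFDerivAt
  have h3 := (hφd.hasMFDerivAt.comp y hf).mfderiv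
  rw [h2.mfderiv_eq, h3] at h1
  -- The inverse tangent trivialization is the derivative of the inverse chart of `N`. The same map
  -- appears in the fibre coordinate and in `dπ`, so that the form reads `y.2` composed with the
  -- first projection.
  have hsymmL := TangentBundle.symmL_trivializationAt (I := 𝓡 2) (x₀ := α.1) (x := (ψ.symm y).1)
    (by rwa [hφ, extChartAt_source] at hsrc)
  rw [← hφ, ModelWithCorners.range_eq_univ, mfderivWithin_univ, ← hyφ] at hsymmL
  ext w
  change (ψ.symm y).2 (mfderiv cotangentModel (𝓡 2) (fun β : CotangentBundle N ↦ β.1) (ψ.symm y)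
    (mfderiv 𝓘(ℝ, Plane × (Plane →L[ℝ] ℝ)) cotangentModel ψ.symm y (w 0))) = y.2 (w 0).1
  have h4 := DFunLike.congr_fun h1 (w 0)
  have h5 : y.2 (w 0).1 = (ψ (ψ.symm y)).2 (w 0).1 := by rw [ψ.right_inv hy]
  rw [h5, hψ, extChartAt_cotangent_snd, ← hψ, hsymmL]
  exact congrArg (ψ.symm y).2 h4.symm

theorem eventuallyEq_tautologicalLinear (α : CotangentBundle N)
    {y : Plane × (Plane →L[ℝ] ℝ)} (hy : y ∈ (extChartAt cotangentModel α).target) :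
    formInChart cotangentModel (tautologicalForm (N := N)) α =ᶠ[𝓝 y]
      tautologicalLinear Plane := by
  filter_upwards [(isOpen_extChartAt_target α).mem_nhds hy] with z hz
  exact formInChart_tautologicalForm α hz

theorem contDiffAt_formInChart_tautologicalForm (α : CotangentBundle N)
    {y : Plane × (Plane →L[ℝ] ℝ)} (hy : y ∈ (extChartAt cotangentModel α).target) :
    ContDiffAt ℝ ∞ (formInChart cotangentModel (tautologicalForm (N := N)) α) y :=
  contDiff_tautologicalLinear.contDiffAt.congr_of_eventuallyEq
    (eventuallyEq_tautologicalLinear α hy)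

theorem extDeriv_formInChart_tautologicalForm (α : CotangentBundle N)
    {y : Plane × (Plane →L[ℝ] ℝ)} (hy : y ∈ (extChartAt cotangentModel α).target)
    (W W' : Plane × (Plane →L[ℝ] ℝ)) :
    extDeriv (formInChart cotangentModel (tautologicalForm (N := N)) α) y ![W, W'] =
      W.2 W'.1 - W'.2 W.1 := by
  rw [(eventuallyEq_tautologicalLinear α hy).extDeriv_eq, extDeriv_tautologicalLinear]

/-- The preferred chart at `α` has the identity as derivative at `α`, so the formula in coordinates
holds verbatim on the tangent space. -/
theorem canonicalSymplecticForm_apply (α : CotangentBundle N)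
    (W W' : Plane × (Plane →L[ℝ] ℝ)) :
    (canonicalSymplecticForm α : (Plane × (Plane →L[ℝ] ℝ)) [⋀^Fin 2]→L[ℝ] ℝ) ![W, W'] =
      W.2 W'.1 - W'.2 W.1 := by
  rw [← extDeriv_formInChart_tautologicalForm α (mem_extChartAt_target α)]
  unfold canonicalSymplecticForm extDerivForm
  rw [mfderiv_extChartAt_self]
  rfl

/-! ### Pullback to a surface and existence of a Lagrangian point -/

variable {S : Type*} [TopologicalSpace S] [ChartedSpace Plane S] [IsManifold (𝓡 2) ∞ S]

/-- The pullback of a form on the cotangent bundle by a map from a surface. -/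
noncomputable def cotangentPullback {k : ℕ}
    (ζ : (α : CotangentBundle N) → TangentSpace cotangentModel α [⋀^Fin k]→L[ℝ] ℝ)
    (β : S → CotangentBundle N) (s : S) : TangentSpace (𝓡 2) s [⋀^Fin k]→L[ℝ] ℝ :=
  (ζ (β s)).compContinuousLinearMap (mfderiv (𝓡 2) cotangentModel β s)

/-- The coordinate expression of a map from a surface to the cotangent bundle. -/
noncomputable def coordExpr (β : S → CotangentBundle N) (c : S) (α : CotangentBundle N)
    (y : Plane) : Plane × (Plane →L[ℝ] ℝ) :=
  extChartAt cotangentModel α (β ((extChartAt (𝓡 2) c).symm y))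

theorem coordExpr_contDiffAt {β : S → CotangentBundle N}
    (hβ : ContMDiff (𝓡 2) cotangentModel ∞ β) {c : S} {α : CotangentBundle N} {y : Plane}
    (hy : y ∈ (extChartAt (𝓡 2) c).target)
    (hα : β ((extChartAt (𝓡 2) c).symm y) ∈ (extChartAt cotangentModel α).source) :
    ContDiffAt ℝ ∞ (coordExpr β c α) y := by
  have h1 : ContMDiffAt 𝓘(ℝ, Plane) (𝓡 2) ∞ (extChartAt (𝓡 2) c).symm y :=
    (contMDiffOn_extChartAt_symm c).contMDiffAt ((isOpen_extChartAt_target c).mem_nhds hy)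
  have h2 : ContMDiffAt cotangentModel 𝓘(ℝ, Plane × (Plane →L[ℝ] ℝ)) ∞
      (extChartAt cotangentModel α) (β ((extChartAt (𝓡 2) c).symm y)) :=
    contMDiffAt_extChartAt' (by rwa [extChartAt_source] at hα)
  exact ((h2.comp y ((hβ _).comp y h1)) : ContMDiffAt _ _ _ _ _).contDiffAt

theorem mfderiv_coordExpr {β : S → CotangentBundle N}
    (hβ : ContMDiff (𝓡 2) cotangentModel ∞ β) {c : S} {α : CotangentBundle N} {y : Plane}
    (hy : y ∈ (extChartAt (𝓡 2) c).target)
    (hα : β ((extChartAt (𝓡 2) c).symm y) ∈ (extChartAt cotangentModel α).source) (u : Plane) :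
    fderiv ℝ (coordExpr β c α) y u =
      mfderiv cotangentModel 𝓘(ℝ, Plane × (Plane →L[ℝ] ℝ)) (extChartAt cotangentModel α)
        (β ((extChartAt (𝓡 2) c).symm y))
        (mfderiv (𝓡 2) cotangentModel β ((extChartAt (𝓡 2) c).symm y)
          (mfderiv 𝓘(ℝ, Plane) (𝓡 2) (extChartAt (𝓡 2) c).symm y u)) := by
  have h1 := mdifferentiableAt_chartSymm c hy
  have h2 : MDifferentiableAt cotangentModel 𝓘(ℝ, Plane × (Plane →L[ℝ] ℝ))
      (extChartAt cotangentModel α) (β ((extChartAt (𝓡 2) c).symm y)) :=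
    mdifferentiableAt_extChartAt (by rwa [extChartAt_source] at hα)
  have h3 : MDifferentiableAt (𝓡 2) cotangentModel β ((extChartAt (𝓡 2) c).symm y) :=
    hβ.mdifferentiable (by simp) _
  have h4 := (h2.hasMFDerivAt.comp y (h3.hasMFDerivAt.comp y h1.hasMFDerivAt)).mfderiv
  rw [mfderiv_eq_fderiv] at h4
  exact DFunLike.congr_fun h4 u

theorem formInChart_cotangentPullback {k : ℕ}
    (ζ : (α : CotangentBundle N) → TangentSpace cotangentModel α [⋀^Fin k]→L[ℝ] ℝ)
    {β : S → CotangentBundle N} (hβ : ContMDiff (𝓡 2) cotangentModel ∞ β) {c : S}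
    {α : CotangentBundle N} {y : Plane} (hy : y ∈ (extChartAt (𝓡 2) c).target)
    (hα : β ((extChartAt (𝓡 2) c).symm y) ∈ (extChartAt cotangentModel α).source) :
    formInChart (𝓡 2) (cotangentPullback ζ β) c y =
      (formInChart cotangentModel ζ α (coordExpr β c α y)).compContinuousLinearMap
        (fderiv ℝ (coordExpr β c α) y) := by
  set ψ := extChartAt cotangentModel α with hψ
  set φ := extChartAt (𝓡 2) c with hφ
  have hF := (coordExpr_contDiffAt hβ hy hα).differentiableAt (by simp)
  have hFy : coordExpr β c α y ∈ ψ.target := ψ.map_source hα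
  have hpt : ψ.symm (coordExpr β c α y) = β (φ.symm y) := ψ.left_inv hα
  have h1 := mdifferentiableAt_chartSymm c hy
  have h2 : MDifferentiableAt (𝓡 2) cotangentModel β (φ.symm y) :=
    hβ.mdifferentiable (by simp) _
  have h3 : MDifferentiableAt 𝓘(ℝ, Plane × (Plane →L[ℝ] ℝ)) cotangentModel ψ.symm
      (coordExpr β c α y) :=
    ((contMDiffOn_extChartAt_symm (I := cotangentModel) (n := ∞) α).contMDiffAt
      ((isOpen_extChartAt_target α).mem_nhds hFy)).mdifferentiableAt (by simp)
  have h4 : β ∘ φ.symm =ᶠ[𝓝 y] ψ.symm ∘ coordExpr β c α := by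
    have hcont : ContinuousAt (fun z ↦ β (φ.symm z)) y :=
      hβ.continuous.continuousAt.comp h1.continuousAt
    filter_upwards [hcont.preimage_mem_nhds ((isOpen_extChartAt_source α).mem_nhds hα)] with z hz
    exact (ψ.left_inv hz).symm
  have h5 := (h2.hasMFDerivAt.comp y h1.hasMFDerivAt).mfderiv
  have h6 := (h3.hasMFDerivAt.comp y hF.hasFDerivAt.hasMFDerivAt).mfderiv
  rw [h4.mfderiv_eq, h6] at h5
  -- The two base points are only propositionally equal. Since all the tangent spaces are the same
  -- model space, substitution transports the form between them.
  have key : ∀ q, q = β (φ.symm y) → ∀ v w : Fin k → Plane × (Plane →L[ℝ] ℝ), v = w →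
      (ζ q : (Plane × (Plane →L[ℝ] ℝ)) [⋀^Fin k]→L[ℝ] ℝ) v =
        (ζ (β (φ.symm y)) : (Plane × (Plane →L[ℝ] ℝ)) [⋀^Fin k]→L[ℝ] ℝ) w := by
    rintro _ rfl _ _ rfl
    rfl
  ext v
  refine (key _ hpt _ _ ?_).symm
  funext i
  exact DFunLike.congr_fun h5 (v i)

/-- A closed surface smoothly mapped to the cotangent bundle has a Lagrangian point. -/
theorem exists_cotangentPullback_eq_zero [CompactSpace S] [T2Space S] [Nonempty S]
    {β : S → CotangentBundle N} (hβ : ContMDiff (𝓡 2) cotangentModel ∞ β) :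
    ∃ s, cotangentPullback canonicalSymplecticForm β s = 0 := by
  have hsrc (q : CotangentBundle N) : ∀ᶠ z in 𝓝 q, z ∈ (extChartAt cotangentModel q).source :=
    extChartAt_source_mem_nhds q
  -- The chart of `T*N` is fixed at the image of `y` while `z` varies, because differentiation needs
  -- the formula on a neighbourhood of `y`.
  have hloc (c : S) {y : Plane} (hy : y ∈ (extChartAt (𝓡 2) c).target) :
      formInChart (𝓡 2) (cotangentPullback (tautologicalForm (N := N)) β) c =ᶠ[𝓝 y]
        fun z ↦ (formInChart cotangentModel (tautologicalForm (N := N))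
          (β ((extChartAt (𝓡 2) c).symm y))
          (coordExpr β c (β ((extChartAt (𝓡 2) c).symm y)) z)).compContinuousLinearMap
            (fderiv ℝ (coordExpr β c (β ((extChartAt (𝓡 2) c).symm y))) z) := by
    have hcont : ContinuousAt (fun z ↦ β ((extChartAt (𝓡 2) c).symm z)) y :=
      hβ.continuous.continuousAt.comp (mdifferentiableAt_chartSymm c hy).continuousAt
    filter_upwards [hcont.eventually (hsrc _), (isOpen_extChartAt_target c).mem_nhds hy]
      with z hz hz'
    exact formInChart_cotangentPullback _ hβ hz' hz
  refine exists_eq_zero_of_exact (η := cotangentPullback (tautologicalForm (N := N)) β) ?_ ?_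
  · intro c y hy
    set α := β ((extChartAt (𝓡 2) c).symm y) with hα
    have hF := coordExpr_contDiffAt hβ hy (mem_extChartAt_source α)
    have hev : ∀ᶠ z in 𝓝 y, coordExpr β c α z ∈ (extChartAt cotangentModel α).target :=
      hF.continuousAt.eventually (extChartAt_target_mem_nhds α)
    have hform : formInChart (𝓡 2) (cotangentPullback (tautologicalForm (N := N)) β) c =ᶠ[𝓝 y]
        fun z ↦ ContinuousAlternatingMap.ofSubsingletonLIE (𝕜 := ℝ) (0 : Fin 1)
          ((coordExpr β c α z).2.comp ((ContinuousLinearMap.fst ℝ Plane (Plane →L[ℝ] ℝ)).comp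
            (fderiv ℝ (coordExpr β c α) z))) := by
      filter_upwards [hloc c hy, hev] with z hz hz'
      rw [hz, ← hα, formInChart_tautologicalForm α hz']
      rfl
    refine ContDiffAt.contDiffWithinAt (ContDiffAt.congr_of_eventuallyEq ?_ hform)
    have h1 : ContDiffAt ℝ 1 (fun z ↦ (coordExpr β c α z).2) y :=
      (contDiffAt_snd.comp y hF).of_le (by exact_mod_cast le_top)
    have h2 : ContDiffAt ℝ 1 (fderiv ℝ (coordExpr β c α)) y :=
      hF.fderiv_right (WithTop.coe_le_coe.2 (le_top : (1 + 1 : ℕ∞) ≤ ⊤))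
    exact (ContinuousAlternatingMap.ofSubsingletonLIE (𝕜 := ℝ) (E := Plane) (F := ℝ)
      (0 : Fin 1)).contDiff.contDiffAt.comp y (h1.clm_comp (contDiffAt_const.clm_comp h2))
  · intro c y hy
    set α := β ((extChartAt (𝓡 2) c).symm y) with hα
    have hα' : α ∈ (extChartAt cotangentModel α).source := mem_extChartAt_source α
    have hF := coordExpr_contDiffAt hβ hy hα'
    have ht : coordExpr β c α y = extChartAt cotangentModel α α := rfl
    -- The exterior derivative commutes with pullback. What remains is the derivative of the
    -- tautological form at `α` in the preferred chart at `α`, which is how the canonical form is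
    -- defined there.
    rw [(hloc c hy).extDeriv_eq, extDeriv_pullback (r := ∞)
      ((contDiffAt_formInChart_tautologicalForm α (by
        rw [ht]; exact mem_extChartAt_target α)).differentiableAt (by simp)) hF (by
        simp only [minSmoothness_of_isRCLikeNormedField]
        exact WithTop.coe_le_coe.2 (le_top : (2 : ℕ∞) ≤ ⊤))]
    ext v
    refine congrArg (extDeriv (formInChart cotangentModel (tautologicalForm (N := N)) α)
      (extChartAt cotangentModel α α)) ?_
    funext i
    exact mfderiv_coordExpr hβ hy hα' (v i)

end Cotangent


/-! ### Linear algebra at a Lagrangian point -/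

/-- A symmetric bilinear form on the plane which is not definite is degenerate or Lorentz. -/
theorem isDegenerate_or_isLorentz {h : Plane → Plane → ℝ} {p q r : ℝ}
    (hh : ∀ a b, h a b = p * (a 0 * b 0) + q * (a 0 * b 1 + a 1 * b 0) + r * (a 1 * b 1))
    {a b : Plane} (hab : a ≠ 0 ∨ b ≠ 0) (hsum : h a a + h b b = 0) :
    IsDegenerate h ∨ IsLorentz h := by
  have hne {c : Plane} (h0 : c 0 ≠ 0 ∨ c 1 ≠ 0) : c ≠ 0 := by
    rintro rfl
    simp at h0
  -- Let `D = p r - q²` be the determinant of the Gram matrix. The vector `(-q, p)` is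
  -- `h`-orthogonal to `(1, 0)` and has square `p D`, of sign opposite to `p` when `D < 0`; likewise
  -- `(r, -q)` and `(0, 1)` when `r ≠ 0`.
  rcases lt_trichotomy (p * r - q * q) 0 with hD | hD | hD
  · right
    rcases lt_trichotomy p 0 with hp | hp | hp
    · refine ⟨!₂[-q, p], !₂[1, 0], ?_, ?_, ?_⟩ <;> simp [hh] <;> nlinarith
    · rcases lt_trichotomy r 0 with hr | hr | hr
      · refine ⟨!₂[r, -q], !₂[0, 1], ?_, ?_, ?_⟩ <;> simp [hh] <;> nlinarith
      · have hq : q ≠ 0 := by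
          rintro rfl
          simp [hp] at hD
        rcases lt_or_gt_of_ne hq with hq | hq
        · refine ⟨!₂[1, -1], !₂[1, 1], ?_, ?_, ?_⟩ <;> simp [hh] <;> linarith
        · refine ⟨!₂[1, 1], !₂[1, -1], ?_, ?_, ?_⟩ <;> simp [hh] <;> linarith
      · refine ⟨!₂[0, 1], !₂[r, -q], ?_, ?_, ?_⟩ <;> simp [hh] <;> nlinarith
    · refine ⟨!₂[1, 0], !₂[-q, p], ?_, ?_, ?_⟩ <;> simp [hh] <;> nlinarith
  · left
    by_cases hpq : p = 0 ∧ q = 0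
    · refine ⟨!₂[1, 0], hne (by simp), fun c ↦ ?_⟩
      simp [hh, hpq.1, hpq.2]
    -- Pairing `(q, -p)` with `c` gives `-D c₁`, which is zero.
    · refine ⟨!₂[q, -p], hne (by simp; tauto), fun c ↦ ?_⟩
      simp only [hh]
      simp
      linear_combination (-c 1) * hD
  · exfalso
    have hp : p ≠ 0 := by
      rintro rfl
      nlinarith [mul_self_nonneg q]
    -- Completing the square, `p h(a, a) = (p a₀ + q a₁)² + D a₁²`. Both terms are nonnegative, so
    -- the vanishing sum forces `a = b = 0`.
    have key : (p * a 0 + q * a 1) ^ 2 + (p * r - q * q) * (a 1) ^ 2 +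
        ((p * b 0 + q * b 1) ^ 2 + (p * r - q * q) * (b 1) ^ 2) = 0 := by
      rw [hh, hh] at hsum
      linear_combination p * hsum
    have ha := mul_nonneg hD.le (sq_nonneg (a 1))
    have hb := mul_nonneg hD.le (sq_nonneg (b 1))
    have ha' := sq_nonneg (p * a 0 + q * a 1)
    have hb' := sq_nonneg (p * b 0 + q * b 1)
    have h1 : (p * r - q * q) * (a 1) ^ 2 = 0 := by linarith
    have h2 : (p * r - q * q) * (b 1) ^ 2 = 0 := by linarith
    have ha1 : a 1 = 0 := by simpa [hD.ne'] using h1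
    have hb1 : b 1 = 0 := by simpa [hD.ne'] using h2
    rw [ha1, hb1] at key
    have ha2 := mul_nonneg (sq_nonneg p) (sq_nonneg (a 0))
    have hb2 := mul_nonneg (sq_nonneg p) (sq_nonneg (b 0))
    have h3 : p ^ 2 * (a 0) ^ 2 = 0 := by linarith
    have h4 : p ^ 2 * (b 0) ^ 2 = 0 := by linarith
    have ha0 : a 0 = 0 := by simpa [hp] using h3
    have hb0 : b 0 = 0 := by simpa [hp] using h4
    rcases hab with hab | hab
    · exact hab (by ext i; fin_cases i <;> simp [ha0, ha1])
    · exact hab (by ext i; fin_cases i <;> simp [hb0, hb1])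

/-- For a plane in `V ⊕ V` on which the form `g(x₂, y₁) - g(y₂, x₁)` vanishes, the neutral metric
is degenerate or Lorentz. -/
theorem isDegenerate_or_isLorentz_of_lagrangian (B : Plane →L[ℝ] Plane →L[ℝ] ℝ)
    (J : Plane →L[ℝ] Plane) (hJ : ∀ v, J (J v) = -v)
    (hBJ : ∀ v w, B (J v) (J w) = B v w) (A₁ A₂ : Plane →L[ℝ] Plane)
    (hL : ∀ a b, B (A₂ a) (A₁ b) - B (A₂ b) (A₁ a) = 0) {h : Plane → Plane → ℝ}
    (hh : ∀ a b, h a b = B (J (A₂ a)) (A₁ b) - B (A₂ b) (J (A₁ a))) :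
    IsDegenerate h ∨ IsLorentz h := by
  have hskew (v w : Plane) : B (J v) w = -B v (J w) := by
    rw [← hBJ v (J w), hJ, map_neg, neg_neg]
  -- A linear map from a space of dimension four to one of dimension two has a kernel.
  obtain ⟨⟨a, b⟩, hker, hne⟩ : ∃ c : Plane × Plane,
      A₁ c.1 + J (A₁ c.2) = 0 ∧ c ≠ 0 := by
    let Φ : Plane × Plane →ₗ[ℝ] Plane :=
      A₁.toLinearMap.coprod (J.toLinearMap.comp A₁.toLinearMap)
    have hdim : Module.finrank ℝ Plane < Module.finrank ℝ (Plane × Plane) := by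
      simp [Module.finrank_prod]
    obtain ⟨c, hc, hc0⟩ :=
      (Submodule.ne_bot_iff _).1 (LinearMap.ker_ne_bot_of_finrank_lt (f := Φ) hdim)
    exact ⟨c, hc, hc0⟩
  -- Here `J (A₁ a) = A₁ b` and `J (A₁ b) = -A₁ a`, so `h a a = -2 B (A₂ a) (A₁ b)` and `h b b = 2 B
  -- (A₂ b) (A₁ a)`. Their sum is `-2` times the Lagrangian condition.
  have hsum : h a a + h b b = 0 := by
    have h1 : A₁ a = -J (A₁ b) := eq_neg_of_add_eq_zero_left hker
    have h2 : J (A₁ a) = A₁ b := by rw [h1, map_neg, hJ, neg_neg]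
    have h3 : J (A₁ b) = -A₁ a := by rw [h1, neg_neg]
    rw [hh, hh, hskew, hskew, h2, h3, map_neg]
    linear_combination (-2) * hL a b
  refine isDegenerate_or_isLorentz (p := h (stdVec 0) (stdVec 0)) (q := h (stdVec 0) (stdVec 1))
    (r := h (stdVec 1) (stdVec 1)) (fun c d ↦ ?_) (a := a) (b := b) ?_ hsum
  · simp only [hh, hskew]
    conv_lhs => rw [plane_eq_sum c, plane_eq_sum d]
    simp only [map_add, map_smul, add_apply, smul_apply, smul_eq_mul]
    ring
  · by_contra! hab
    exact hne (by rw [hab.1, hab.2]; rfl)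


/-! ### The metric in a chart and the Koszul formula -/

section Flat

variable {N : Type*} [TopologicalSpace N] [ChartedSpace Plane N] [IsManifold (𝓡 2) ∞ N]

theorem contMDiff_flat (g : SurfaceMetric N) :
    ContMDiff (𝓡 2).tangent cotangentModel ∞ (flat g) := by
  have h1 : ContMDiff (𝓡 2).tangent (𝓡 2) ∞ (fun p : TangentBundle (𝓡 2) N ↦ p.1) :=
    contMDiff_proj _
  exact ContMDiff.clm_bundle_apply (𝕜 := ℝ) (IB := 𝓡 2) (IM := (𝓡 2).tangent) (F₁ := Plane)
    (F₂ := Plane →L[ℝ] ℝ) (E₁ := fun z : N ↦ TangentSpace (𝓡 2) z)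
    (E₂ := fun z : N ↦ TangentSpace (𝓡 2) z →L[ℝ] ℝ) (b := fun p : TangentBundle (𝓡 2) N ↦ p.1)
    (ϕ := fun p ↦ g.inner p.1) (v := fun p ↦ p.2) (g.contMDiff.comp h1) contMDiff_id

/-- The metric read in the trivialization of the tangent bundle at `x`. -/
noncomputable def metricInChart (g : SurfaceMetric N) (x x' : N) : Plane →L[ℝ] Plane →L[ℝ] ℝ :=
  ContinuousLinearMap.inCoordinates Plane (fun z : N ↦ TangentSpace (𝓡 2) z) (Plane →L[ℝ] ℝ)
    (fun z : N ↦ TangentSpace (𝓡 2) z →L[ℝ] ℝ) x x' x x' (g.inner x')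

theorem metricInChart_apply (g : SurfaceMetric N) {x x' : N} (hx' : x' ∈ (chartAt Plane x).source)
    (v w : Plane) : metricInChart g x x' v w =
      g.inner x' ((trivializationAt Plane (fun z : N ↦ TangentSpace (𝓡 2) z) x).symmL ℝ x' v)
        ((trivializationAt Plane (fun z : N ↦ TangentSpace (𝓡 2) z) x).symmL ℝ x' w) := by
  rw [← extChartAt_cotangent_snd ⟨x, 0⟩ ⟨x', g.inner x'
    ((trivializationAt Plane (fun z : N ↦ TangentSpace (𝓡 2) z) x).symmL ℝ x' v)⟩ w]
  rw [FiberBundle.extChartAt]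
  change (Trivialization.continuousLinearMapAt ℝ (trivializationAt (Plane →L[ℝ] ℝ)
    (fun z : N ↦ TangentSpace (𝓡 2) z →L[ℝ] ℝ) x) x' _) w = _
  rw [Trivialization.continuousLinearMapAt_apply_of_mem]
  · rfl
  · exact ⟨hx', trivial⟩

theorem mdifferentiableAt_metricInChart (g : SurfaceMetric N) (x : N) :
    MDifferentiableAt (𝓡 2) 𝓘(ℝ, Plane →L[ℝ] Plane →L[ℝ] ℝ) (metricInChart g x) x :=
  ((contMDiffAt_hom_bundle _).1 g.contMDiff.contMDiffAt).2.mdifferentiableAt (by simp)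

theorem differentiableAt_metricInChart (g : SurfaceMetric N) (x : N) :
    DifferentiableAt ℝ (fun y ↦ metricInChart g x ((extChartAt (𝓡 2) x).symm y))
      (extChartAt (𝓡 2) x x) := by
  have h1 := mdifferentiableAt_chartSymm x (mem_extChartAt_target (I := 𝓡 2) x)
  have h2 := mdifferentiableAt_metricInChart g x
  exact (MDifferentiableAt.comp_of_eq _ h2 h1 (extChartAt_to_inv x)).differentiableAt

theorem symmL_self (x : N) (v : Plane) :
    ((trivializationAt Plane (fun z : N ↦ TangentSpace (𝓡 2) z) x).symmL ℝ x v : Plane) = v := by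
  rw [TangentBundle.symmL_trivializationAt (mem_chart_source _ x),
    mfderivWithin_range_extChartAt_symm]
  rfl

theorem metricInChart_self (g : SurfaceMetric N) (x : N) : metricInChart g x x = g.inner x := by
  ext v w
  rw [metricInChart_apply g (mem_chart_source _ x)]
  erw [symmL_self, symmL_self]
  rfl

theorem metricMatrix_eq (g : SurfaceMetric N) (x : N) {y : Plane}
    (hy : y ∈ (extChartAt (𝓡 2) x).target) (i j : Fin 2) : metricMatrix g x y i j =
      metricInChart g x ((extChartAt (𝓡 2) x).symm y) (stdVec i) (stdVec j) := by
  have h : (extChartAt (𝓡 2) x).symm y ∈ (chartAt Plane x).source := by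
    have := (extChartAt (𝓡 2) x).map_target hy
    rwa [extChartAt_source] at this
  rw [metricInChart_apply g h]
  have := TangentBundle.symmL_trivializationAt (I := 𝓡 2) h
  rw [ModelWithCorners.range_eq_univ, mfderivWithin_univ,
    (extChartAt (𝓡 2) x).right_inv hy] at this
  rw [this]
  rfl

theorem fderiv_bilinear_apply {E : Type*} [NormedAddCommGroup E] [NormedSpace ℝ E]
    {B : E → E →L[ℝ] E →L[ℝ] ℝ} {y : E} (hB : DifferentiableAt ℝ B y) (u v w : E) :
    fderiv ℝ (fun z ↦ B z v w) y u = fderiv ℝ B y u v w := by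
  have hd := (hB.hasFDerivAt.clm_apply (hasFDerivAt_const v y)).clm_apply (hasFDerivAt_const w y)
  rw [hd.fderiv]
  simp

/-- The derivative at `x` of the metric in the preferred chart at `x`. -/
noncomputable def metricDeriv (g : SurfaceMetric N) (x : N) (u v w : Plane) : ℝ :=
  fderiv ℝ (fun y ↦ metricInChart g x ((extChartAt (𝓡 2) x).symm y)) (extChartAt (𝓡 2) x x) u v w

theorem metricPartial_eq (g : SurfaceMetric N) (x : N) (k i j : Fin 2) :
    metricPartial g x k i j = metricDeriv g x (stdVec k) (stdVec i) (stdVec j) := by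
  have h : (fun y ↦ metricMatrix g x y i j) =ᶠ[𝓝 (extChartAt (𝓡 2) x x)] fun y ↦
      metricInChart g x ((extChartAt (𝓡 2) x).symm y) (stdVec i) (stdVec j) := by
    filter_upwards [extChartAt_target_mem_nhds (I := 𝓡 2) x] with y hy
    exact metricMatrix_eq g x hy i j
  rw [metricPartial, h.fderiv_eq, fderiv_bilinear_apply (differentiableAt_metricInChart g x)]
  rfl

theorem metricDeriv_symm (g : SurfaceMetric N) (x : N) (u v w : Plane) :
    metricDeriv g x u v w = metricDeriv g x u w v := by
  have h : (fun y ↦ metricInChart g x ((extChartAt (𝓡 2) x).symm y) v w)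
      =ᶠ[𝓝 (extChartAt (𝓡 2) x x)] fun y ↦
      metricInChart g x ((extChartAt (𝓡 2) x).symm y) w v := by
    filter_upwards [extChartAt_target_mem_nhds (I := 𝓡 2) x] with y hy
    have h : (extChartAt (𝓡 2) x).symm y ∈ (chartAt Plane x).source := by
      have := (extChartAt (𝓡 2) x).map_target hy
      rwa [extChartAt_source] at this
    rw [metricInChart_apply g h, metricInChart_apply g h, g.symm]
  rw [metricDeriv, metricDeriv, ← fderiv_bilinear_apply (differentiableAt_metricInChart g x),
    ← fderiv_bilinear_apply (differentiableAt_metricInChart g x), h.fderiv_eq]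

set_option synthInstance.maxHeartbeats 400000 in
theorem trilinear_apply_sum {E : Type*} [NormedAddCommGroup E] [NormedSpace ℝ E]
    (D : E →L[ℝ] E →L[ℝ] E →L[ℝ] ℝ) (e : Fin 2 → E) (u v w : Fin 2 → ℝ) :
    D (u 0 • e 0 + u 1 • e 1) (v 0 • e 0 + v 1 • e 1) (w 0 • e 0 + w 1 • e 1) =
      ∑ k, ∑ i, ∑ l, u k * v i * w l * D (e k) (e i) (e l) := by
  simp only [Fin.sum_univ_two, map_add, map_smul, add_apply, smul_apply, smul_eq_mul]
  ring

theorem metricDeriv_eq_sum (g : SurfaceMetric N) (x : N) (u v w : Plane) :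
    metricDeriv g x u v w =
      ∑ k, ∑ i, ∑ l, u k * v i * w l * metricPartial g x k i l := by
  simp_rw [metricPartial_eq]
  conv_lhs => rw [plane_eq_sum u, plane_eq_sum v, plane_eq_sum w]
  exact trilinear_apply_sum _ stdVec u v w

theorem metricMatrix_self (g : SurfaceMetric N) (x : N) (i j : Fin 2) :
    metricMatrix g x (extChartAt (𝓡 2) x x) i j = metricInChart g x x (stdVec i) (stdVec j) := by
  rw [metricMatrix_eq g x (mem_extChartAt_target x), extChartAt_to_inv]

theorem metricInChart_eq_sum (g : SurfaceMetric N) (x : N) (v w : Plane) :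
    metricInChart g x x v w =
      ∑ i, ∑ k, v i * w k * metricMatrix g x (extChartAt (𝓡 2) x x) i k := by
  simp_rw [metricMatrix_self]
  conv_lhs => rw [plane_eq_sum v, plane_eq_sum w]
  simp only [Fin.sum_univ_two, map_add, map_smul, add_apply, smul_apply, smul_eq_mul]
  ring

/-- A kernel vector of the matrix would be a nonzero null vector of a positive definite form. -/
theorem isUnit_det_metricMatrix (g : SurfaceMetric N) (x : N) :
    IsUnit (metricMatrix g x (extChartAt (𝓡 2) x x)).det := by
  rw [isUnit_iff_ne_zero]
  intro h0
  obtain ⟨v, hv, hv0⟩ := Matrix.exists_mulVec_eq_zero_iff.2 h0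
  have h1 : metricInChart g x x (WithLp.toLp 2 v) (WithLp.toLp 2 v) = 0 := by
    have e0 := congrFun hv0 0
    have e1 := congrFun hv0 1
    simp only [Matrix.mulVec, dotProduct, Fin.sum_univ_two, Pi.zero_apply] at e0 e1
    rw [metricInChart_eq_sum]
    simp only [Fin.sum_univ_two]
    linear_combination v 0 * e0 + v 1 * e1
  rw [metricInChart_self] at h1
  refine (g.pos x (WithLp.toLp 2 v : Plane) fun h ↦ hv ?_).ne' h1
  exact congrArg WithLp.ofLp (h : (WithLp.toLp 2 v : Plane) = 0)

/-- The Koszul formula for the Levi-Civita connection. -/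
theorem inner_christoffelMap (g : SurfaceMetric N) (x : N) (v a w : Plane) :
    metricInChart g x x (christoffelMap g x v a) w = 1 / 2 *
      (metricDeriv g x a v w + metricDeriv g x v a w - metricDeriv g x w a v) := by
  set G := metricMatrix g x (extChartAt (𝓡 2) x x) with hG
  have hcoord (k : Fin 2) : christoffelMap g x v a k =
      ∑ i, ∑ l, christoffel g x k i l * v l * a i := by
    fin_cases k <;> simp [christoffelMap, Fin.sum_univ_two, stdVec]
  have hGG : G * G⁻¹ = 1 := Matrix.mul_nonsing_inv _ (isUnit_det_metricMatrix g x)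
  have hsymm (k m : Fin 2) : G k m = G m k := by
    rw [hG, metricMatrix_self, metricMatrix_self, metricInChart_self]
    exact g.symm x _ _
  -- Lowering the upper index of the Christoffel symbol cancels the inverse matrix in its
  -- definition.
  have hlower (i l : Fin 2) : ∀ m, G m 0 * christoffel g x 0 i l + G m 1 * christoffel g x 1 i l =
      1 / 2 * (metricPartial g x i l m + metricPartial g x l i m - metricPartial g x m i l) := by
    have e (m n : Fin 2) : G m 0 * G⁻¹ 0 n + G m 1 * G⁻¹ 1 n = (1 : Matrix _ _ ℝ) m n := by
      rw [← hGG, Matrix.mul_apply, Fin.sum_univ_two]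
    have e00 := e 0 0
    have e01 := e 0 1
    have e10 := e 1 0
    have e11 := e 1 1
    simp only [Matrix.one_apply_eq, Matrix.one_apply_ne, ne_eq, zero_ne_one, one_ne_zero,
      not_false_eq_true] at e00 e01 e10 e11
    simp only [christoffel, Fin.sum_univ_two, ← hG]
    refine Fin.forall_fin_two.2 ⟨?_, ?_⟩
    · linear_combination
        1 / 2 * (metricPartial g x i l 0 + metricPartial g x l i 0 - metricPartial g x 0 i l) *
          e00 +
        1 / 2 * (metricPartial g x i l 1 + metricPartial g x l i 1 - metricPartial g x 1 i l) * e01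
    · linear_combination
        1 / 2 * (metricPartial g x i l 0 + metricPartial g x l i 0 - metricPartial g x 0 i l) *
          e10 +
        1 / 2 * (metricPartial g x i l 1 + metricPartial g x l i 1 - metricPartial g x 1 i l) * e11
  rw [metricInChart_eq_sum, metricDeriv_eq_sum, metricDeriv_eq_sum, metricDeriv_eq_sum]
  simp only [hcoord, Fin.sum_univ_two, ← hG]
  rw [hsymm 0 1]
  have h (i l : Fin 2) := hlower i l 0
  simp only [hsymm 0 1] at h
  linear_combination w 0 * (a 0 * v 0 * h 0 0 + a 0 * v 1 * h 0 1 + a 1 * v 0 * h 1 0 +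
      a 1 * v 1 * h 1 1) + w 1 * (a 0 * v 0 * hlower 0 0 1 + a 0 * v 1 * hlower 0 1 1 +
      a 1 * v 0 * hlower 1 0 1 + a 1 * v 1 * hlower 1 1 1)

end Flat


/-! ### The symplectic form in the Levi-Civita splitting -/

section Splitting

variable {N : Type*} [TopologicalSpace N] [ChartedSpace Plane N] [IsManifold (𝓡 2) ∞ N]

/-- In charts `flat` has the shape `(y, v) ↦ (y, B y v)`, where `B y` is the metric at `y`. -/
theorem hasFDerivAt_prodMk_apply {E F : Type*} [NormedAddCommGroup E] [NormedSpace ℝ E]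
    [NormedAddCommGroup F] [NormedSpace ℝ F] {B : E → E →L[ℝ] F} {z : E × E}
    (hB : DifferentiableAt ℝ B z.1) :
    ∃ L : E × E →L[ℝ] E × F, HasFDerivAt (fun q : E × E ↦ (q.1, B q.1 q.2)) L z ∧
      ∀ X, L X = (X.1, fderiv ℝ B z.1 X.1 z.2 + B z.1 X.2) := by
  have h1 : HasFDerivAt (fun q : E × E ↦ B q.1)
      ((fderiv ℝ B z.1).comp (ContinuousLinearMap.fst ℝ E E)) z :=
    hB.hasFDerivAt.comp z hasFDerivAt_fst
  refine ⟨_, (hasFDerivAt_fst (𝕜 := ℝ)).prodMk (h1.clm_apply (hasFDerivAt_snd (𝕜 := ℝ))),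
    fun X ↦ Prod.ext rfl ?_⟩
  simp [add_comm]

/-- The differential of `flat`, in the preferred charts. -/
theorem mfderiv_flat_apply (g : SurfaceMetric N) (p : TangentBundle (𝓡 2) N)
    (X : Plane × Plane) :
    let Y : Plane × (Plane →L[ℝ] ℝ) := mfderiv (𝓡 2).tangent cotangentModel (flat g) p X
    Y.1 = X.1 ∧ ∀ w, Y.2 w = metricDeriv g p.1 X.1 p.2 w + metricInChart g p.1 p.1 X.2 w := by
  intro Y
  set e := extChartAt (𝓡 2).tangent p with he
  set ψ := extChartAt cotangentModel (flat g p) with hψ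
  have he1 (q : TangentBundle (𝓡 2) N) : (e q).1 = extChartAt (𝓡 2) p.1 q.1 := by
    rw [he, FiberBundle.extChartAt]; rfl
  have he2 (q : TangentBundle (𝓡 2) N) (hq : q.1 ∈ (chartAt Plane p.1).source) : (e q).2 =
      (trivializationAt Plane (fun z : N ↦ TangentSpace (𝓡 2) z) p.1).continuousLinearMapAt ℝ q.1
        q.2 := by
    rw [he, FiberBundle.extChartAt, Trivialization.continuousLinearMapAt_apply_of_mem]
    · rfl
    · exact hq
  have hep : e p = (extChartAt (𝓡 2) p.1 p.1, p.2) := by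
    refine Prod.ext (he1 p) ?_
    rw [he2 p (mem_chart_source _ _), TangentBundle.continuousLinearMapAt_trivializationAt
      (mem_chart_source _ _), mfderiv_extChartAt_self]
    rfl
  let B : Plane → Plane →L[ℝ] Plane →L[ℝ] ℝ := fun y ↦
    metricInChart g p.1 ((extChartAt (𝓡 2) p.1).symm y)
  have hB : DifferentiableAt ℝ B (e p).1 := by
    rw [hep]; exact differentiableAt_metricInChart g p.1
  obtain ⟨L, hL, hLX⟩ := hasFDerivAt_prodMk_apply hB
  have hev : (fun q ↦ ψ (flat g q)) =ᶠ[𝓝 p] fun q ↦ ((e q).1, B (e q).1 (e q).2) := by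
    have hsrc : ∀ᶠ q in 𝓝 p, q ∈ e.source := extChartAt_source_mem_nhds p
    filter_upwards [hsrc] with q hq
    have hq' : q.1 ∈ (chartAt Plane p.1).source := by
      rw [he, extChartAt_source] at hq
      exact (TangentBundle.mem_chart_source_iff q p).1 hq
    refine Prod.ext ?_ ?_
    · rw [hψ, extChartAt_cotangent_fst, he1]
      rfl
    · ext w
      rw [hψ, extChartAt_cotangent_snd]
      simp only [B]
      rw [he1, (extChartAt (𝓡 2) p.1).left_inv (by rwa [extChartAt_source]),
        metricInChart_apply g hq', he2 q hq',
        Trivialization.symmL_continuousLinearMapAt _ (by exact hq')]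
      rfl
  -- Both preferred charts have the identity as derivative at their centres, so the differential of
  -- `flat` is the derivative of its coordinate expression.
  have hed : HasMFDerivAt (𝓡 2).tangent 𝓘(ℝ, Plane × Plane) e p
      (ContinuousLinearMap.id ℝ (Plane × Plane)) := by
    have := (mdifferentiableAt_extChartAt (I := (𝓡 2).tangent)
      (mem_chart_source _ p)).hasMFDerivAt
    rwa [mfderiv_extChartAt_self] at this
  have hψd : HasMFDerivAt cotangentModel 𝓘(ℝ, Plane × (Plane →L[ℝ] ℝ)) ψ (flat g p)
      (ContinuousLinearMap.id ℝ (Plane × (Plane →L[ℝ] ℝ))) := by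
    have := (mdifferentiableAt_extChartAt (I := cotangentModel)
      (mem_chart_source _ (flat g p))).hasMFDerivAt
    rwa [mfderiv_extChartAt_self] at this
  have hfd := ((contMDiff_flat g).mdifferentiable (by simp) p).hasMFDerivAt
  have h1 := (hψd.comp p hfd).mfderiv
  have h2 := (hL.hasMFDerivAt.comp p hed).mfderiv
  have h3 : Y = L X := by
    have h4 := hev.mfderiv_eq (I := (𝓡 2).tangent) (I' := 𝓘(ℝ, Plane × (Plane →L[ℝ] ℝ)))
    exact DFunLike.congr_fun (h1.symm.trans (h4.trans h2)) X
  rw [h3]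
  rw [hLX X, hep]
  refine ⟨rfl, fun w ↦ ?_⟩
  simp only [B]
  rw [extChartAt_to_inv]
  rfl

/-- The symplectic form of `TN` in terms of the Levi-Civita splitting. -/
theorem symplecticForm_apply (g : SurfaceMetric N) (p : TangentBundle (𝓡 2) N)
    (X Y : TangentSpace (𝓡 2).tangent p) :
    symplecticForm g p ![X, Y] =
      g.inner p.1 (splitting g p X).2 (splitting g p Y).1 -
        g.inner p.1 (splitting g p Y).2 (splitting g p X).1 := by
  let X' : Plane × Plane := X
  let Y' : Plane × Plane := Y
  let v : Plane := p.2
  let DX : Plane × (Plane →L[ℝ] ℝ) := mfderiv (𝓡 2).tangent cotangentModel (flat g) p X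
  let DY : Plane × (Plane →L[ℝ] ℝ) := mfderiv (𝓡 2).tangent cotangentModel (flat g) p Y
  have hX := mfderiv_flat_apply g p X'
  have hY := mfderiv_flat_apply g p Y'
  have h1 : symplecticForm g p ![X, Y] = DX.2 DY.1 - DY.2 DX.1 := by
    rw [← canonicalSymplecticForm_apply (flat g p) DX DY]
    change canonicalSymplecticForm (flat g p) _ = _
    congr 1
    funext i; fin_cases i <;> rfl
  have hs (Z : Plane × Plane) : (splitting g p Z : Plane × Plane) =
      (Z.1, Z.2 + christoffelMap g p.1 v Z.1) := by
    unfold splitting connectionMap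
    rw [projDeriv_eq, fibreDeriv_eq, chartDeriv_eq]
    erw [ContinuousLinearMap.inverse_id]
    rfl
  have hX1 : DX.1 = X'.1 := hX.1
  have hY1 : DY.1 = Y'.1 := hY.1
  have hX2 : DX.2 Y'.1 = metricDeriv g p.1 X'.1 v Y'.1 + metricInChart g p.1 p.1 X'.2 Y'.1 :=
    hX.2 Y'.1
  have hY2 : DY.2 X'.1 = metricDeriv g p.1 Y'.1 v X'.1 + metricInChart g p.1 p.1 Y'.2 X'.1 :=
    hY.2 X'.1
  have hr : g.inner p.1 (splitting g p X).2 (splitting g p Y).1 -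
      g.inner p.1 (splitting g p Y).2 (splitting g p X).1 =
      metricInChart g p.1 p.1 (X'.2 + christoffelMap g p.1 v X'.1) Y'.1 -
        metricInChart g p.1 p.1 (Y'.2 + christoffelMap g p.1 v Y'.1) X'.1 := by
    rw [metricInChart_self]
    have hsX := hs X'
    have hsY := hs Y'
    change g.inner p.1 (splitting g p X' : Plane × Plane).2 (splitting g p Y' : Plane × Plane).1 -
      g.inner p.1 (splitting g p Y' : Plane × Plane).2 (splitting g p X' : Plane × Plane).1 = _
    rw [hsX, hsY]
    rfl
  -- By the Koszul formula the two Christoffel terms share the derivative of the metric along `v`,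
  -- which cancels in the difference; the other derivatives combine into those coming from the
  -- differential of `flat`.
  rw [h1, hr, hX1, hY1, hX2, hY2, map_add, map_add, add_apply, add_apply,
    inner_christoffelMap, inner_christoffelMap, metricDeriv_symm g p.1 v X'.1 Y'.1,
    metricDeriv_symm g p.1 X'.1 Y'.1, metricDeriv_symm g p.1 Y'.1 X'.1]
  ring

end Splitting

end NeutralKahler

/-! ### The theorem on closed surfaces -/

theorem corollary1
    {N : Type*} [TopologicalSpace N] [ChartedSpace (EuclideanSpace ℝ (Fin 2)) N]
    [IsManifold (𝓡 2) ∞ N]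
    (g : NeutralKahler.SurfaceMetric N) (j : NeutralKahler.CompatibleComplexStructure g)
    {S : Type*} [TopologicalSpace S] [ChartedSpace (EuclideanSpace ℝ (Fin 2)) S]
    [IsManifold (𝓡 2) ∞ S] [CompactSpace S] [T2Space S] [Nonempty S]
    (f : S → TangentBundle (𝓡 2) N) (hf : NeutralKahler.IsImmersedSurface f) :
    (¬ ∀ s : S, NeutralKahler.IsPositiveDefinite (NeutralKahler.inducedMetric g j f s)) ∧
    (¬ ∀ s : S, NeutralKahler.IsNegativeDefinite (NeutralKahler.inducedMetric g j f s)) ∧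
    ∃ s : S, NeutralKahler.inducedForm g f s = 0 ∧
      (NeutralKahler.IsDegenerate (NeutralKahler.inducedMetric g j f s) ∨
        NeutralKahler.IsLorentz (NeutralKahler.inducedMetric g j f s)) := by
  open NeutralKahler in
  have hflat := contMDiff_flat g
  -- `Ω` is itself a pullback by `flat`, so its Lagrangian points along `f` are those of the
  -- canonical form along `flat g ∘ f`.
  obtain ⟨s, hs⟩ := exists_cotangentPullback_eq_zero (hflat.comp hf.1)
  have hform : inducedForm g f s = 0 := by
    have h1 := mfderiv_comp s (hflat.mdifferentiable (by simp) (f s))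
      (hf.1.mdifferentiable (by simp) s)
    unfold cotangentPullback at hs
    rw [h1] at hs
    exact hs
  let A₁ : Plane →L[ℝ] Plane :=
    (ContinuousLinearMap.fst ℝ Plane Plane).comp ((splitting g (f s)).comp (surfaceDeriv f s))
  let A₂ : Plane →L[ℝ] Plane :=
    (ContinuousLinearMap.snd ℝ Plane Plane).comp ((splitting g (f s)).comp (surfaceDeriv f s))
  let B : Plane →L[ℝ] Plane →L[ℝ] ℝ := g.inner (f s).1
  let J : Plane →L[ℝ] Plane := j.rot (f s).1
  have hmetric (a b : Plane) :
      inducedMetric g j f s a b = B (J (A₂ a)) (A₁ b) - B (A₂ b) (J (A₁ a)) := by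
    unfold inducedMetric neutralMetric
    rw [symplecticForm_apply]
    have h3 (X : TangentSpace (𝓡 2).tangent (f s)) :
        splitting g (f s) (complexStructure g j (f s) X) =
          (j.rot (f s).1 (splitting g (f s) X).1, j.rot (f s).1 (splitting g (f s) X).2) := by
      obtain ⟨e, he⟩ := splitting_isInvertible g (f s)
      unfold complexStructure
      rw [← he]
      simp
      rfl
    rw [h3]
    rfl
  have hlagr (a b : Plane) : B (A₂ a) (A₁ b) - B (A₂ b) (A₁ a) = 0 := by
    have h1 : inducedForm g f s ![a, b] = 0 := by rw [hform]; rfl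
    have h2 : inducedForm g f s ![a, b] =
        symplecticForm g (f s) ![surfaceDeriv f s a, surfaceDeriv f s b] := by
      change symplecticForm g (f s) _ = _
      congr 1
      funext i; fin_cases i <;> rfl
    rw [← h1, h2, symplecticForm_apply]
    rfl
  -- `IsLorentz` does not say that its two vectors are nonzero; this gives it, since their squares
  -- are nonzero.
  have hzero : inducedMetric g j f s (0 : Plane) (0 : Plane) = 0 := by
    rw [hmetric]
    simp
  have hmain : IsDegenerate (inducedMetric g j f s) ∨ IsLorentz (inducedMetric g j f s) :=
    isDegenerate_or_isLorentz_of_lagrangian B J (j.rot_rot (f s).1) (j.inner_rot (f s).1) A₁ A₂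
      hlagr hmetric
  refine ⟨fun h ↦ ?_, fun h ↦ ?_, s, hform, hmain⟩
  · rcases hmain with ⟨a, ha, h0⟩ | ⟨a, b, ha, hb, -⟩
    · exact (h s a ha).ne' (h0 a)
    · refine (h s b ?_).not_gt hb
      rintro rfl
      exact hb.ne hzero
  · rcases hmain with ⟨a, ha, h0⟩ | ⟨a, b, ha, hb, -⟩
    · exact (h s a ha).ne (h0 a)
    · refine (h s a ?_).not_gt ha
      rintro rfl
      exact ha.ne' hzero
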